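/- **Setting.** Let $\mathbb T^2=(\mathbb R/2\pi\mathbb Z)^2$ and let $H$ be the space of $w\in L^2(\mathbb T^2,\mathbb R)$ with $\int w\,dx=0$, with the $L^2$ norm $\|\cdot\|$ and scalar product $\langle\cdot,\cdot\rangle$. Write $\hat w_k=\frac1{2\pi}\int w(x)e^{-ik\cdot x}dx$, $\|w\|_1^2=\sum_k|k|^2|\hat w_k|^2$ and $V=\{w\in H:\|w\|_1<\infty\}$. For $k\in\mathbb Z^2\setminus\{0\}$ let $e_k(x)=\sin(k\cdot x)$ if $k_2>0$, or if $k_2=0$ and $k_1>0$; otherwise let $e_k(x)=\cos(k\cdot x)$. Let $\mathcal K$ be the Biot–Savart operator: $\mathcal Kw$ is the divergence-free, mean-zero vector field $u$ with $\partial_2u_1-\partial_1u_2=w$. Let $B(u,w)=-(u\cdot\nabla)w$. Let $\nu>0$. Let $\mathcal Z_0\subset\mathbb Z^2\setminus\{0\}$ be a finite set with $-\mathcal Z_0=\mathcal Z_0$ that generates $\mathbb Z^2$ as a group and contains two non-parallel vectors $m,n$ with $|m|\ne|n|$. Let $b_k\neq0$ be real numbers ($k\in\mathcal Z_0$). Let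 $\nu_S$ be a measure on $(0,\infty)$ with $\int_0^\infty(1\wedge u)\,\nu_S(du)<\infty$, $\nu_S((0,\infty))=\infty$ and $\int_0^\infty(e^{\zeta u}-1)\,\nu_S(du)<\infty$ for some $\zeta>0$. Let $W=(W^k)_{k\in\mathcal Z_0}$ be a standard $|\mathcal Z_0|$-dimensional Brownian motion. Let $S$ be a pure jump subordinator with Lévy measure $\nu_S$, without drift, independent of $W$. Put $\eta(t)=\sum_{k\in\mathcal Z_0}b_kW^k_{S_t}e_k$. Consider $$\partial_tw=\nu\Delta w+B(\mathcal Kw,w)+\partial_t\eta,\qquad w(0)=w_0\in H.$$ A process $w$ with values in $H$ is a solution if, almost surely, $v=w-\eta$ belongs to $C([0,\infty);H)\cap L^2_{\rm loc}([0,\infty);V)$ and, for all $t\ge0$ and $k\in\mathbb Z^2\setminus\{0\}$, $$\langle v(t),e_k\rangle=\langle w_0,e_k\rangle+\int_0^t\Big(-\nu|k|^2\langle w(s),e_k\rangle+\int_{\mathbb T^2}w(s)\,(\mathcal Kw(s)\cdot\nabla e_k)\,dx\Big)ds .$$ Let $P_t(w_0,A)=\mathbb P(w(t)\in A\mid w(0)=w_0)$,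 for Borel sets $A\subseteq H$, be the law of $w(t)$ when $w$ is the solution started from $w_0$. **Proposition 1.2 (weak irreducibility).** For all $\mathcal C>0$ and $\gamma>0$ there exists $T>0$, depending only on $\mathcal C$, $\gamma$ and the data $\nu,\mathcal Z_0,(b_k),\nu_S$, such that $$\inf_{\|w_0\|\le\mathcal C}P_T(w_0,\mathcal B_\gamma)>0,\qquad \mathcal B_\gamma=\{w\in H:\|w\|\le\gamma\}.$$ That is, there is $p>0$, depending on the same quantities, such that $P_T(w_0,\mathcal B_\gamma)\ge p$ whenever $\|w_0\|\le\mathcal C$. -/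

import Mathlib

open MeasureTheory ProbabilityTheory
open scoped NNReal ENNReal

namespace StochNS

noncomputable section

/-! ### The torus, Fourier modes and the phase space -/

instance : Fact (0 < 2 * Real.pi) := ⟨Real.two_pi_pos⟩

/-- The two-dimensional torus `(ℝ / 2πℤ)²`, with Lebesgue measure of total mass `4π²`. -/
abbrev Torus : Type := Fin 2 → AddCircle (2 * Real.pi)

/-- Real-valued `L²` on the torus. -/
abbrev L2 : Type := Lp ℝ 2 (volume : Measure Torus)

/-- `H`: the square integrable functions of mean zero, with the `L²` norm. -/
def H : Submodule ℝ L2 where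
  carrier := {w | ∫ x, w x = 0}
  zero_mem' := by
    simp
  add_mem' := by
    intro u v hu hv
    have iu : Integrable (fun x => u x) (volume : Measure Torus) :=
      (Lp.memLp u).integrable (by norm_num)
    have iv : Integrable (fun x => v x) (volume : Measure Torus) :=
      (Lp.memLp v).integrable (by norm_num)
    have h : ∫ x, (u + v) x = ∫ x, (u x + v x) := integral_congr_ae (Lp.coeFn_add u v)
    have hu' : ∫ x, u x = 0 := hu
    have hv' : ∫ x, v x = 0 := hv
    change ∫ x, (u + v) x = 0
    rw [h, integral_add iu iv, hu', hv', add_zero]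
  smul_mem' := by
    intro c u hu
    have h : ∫ x, (c • u) x = ∫ x, c * u x := integral_congr_ae (Lp.coeFn_smul c u)
    have hu' : ∫ x, u x = 0 := hu
    change ∫ x, (c • u) x = 0
    rw [h, integral_const_mul, hu', mul_zero]

/-- `H` carries its Borel `σ`-algebra. -/
instance : MeasurableSpace H := borel H

instance : BorelSpace H := ⟨rfl⟩

/-- `|k|²` for a wave vector `k`. -/
def normSq (k : Fin 2 → ℤ) : ℝ := (k 0 : ℝ) ^ 2 + (k 1 : ℝ) ^ 2

/-- `k^⊥ = (-k₂, k₁)`. -/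
def perp (k : Fin 2 → ℤ) : Fin 2 → ℤ := ![-k 1, k 0]

/-- The character `x ↦ exp (i k·x)`. -/
def expMode (k : Fin 2 → ℤ) : C(Torus, ℂ) where
  toFun x := ∏ j : Fin 2, fourier (k j) (x j)
  continuous_toFun := by fun_prop

/-- The half lattice `ℤ²₊ = {k₂ > 0} ∪ {k₂ = 0, k₁ > 0}`. -/
def upperHalf (k : Fin 2 → ℤ) : Prop := 0 < k 1 ∨ (k 1 = 0 ∧ 0 < k 0)

open Classical in
/-- The real mode `e_k`: `sin (k·x)` for `k ∈ ℤ²₊` and `cos (k·x)` for `k ∈ -ℤ²₊`. -/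
def mode (k : Fin 2 → ℤ) : C(Torus, ℝ) where
  toFun x := if upperHalf k then (expMode k x).im else (expMode k x).re
  continuous_toFun := by split_ifs <;> fun_prop

open Classical in
/-- The partial derivative `∂_j e_k`: `k_j cos (k·x)` for `k ∈ ℤ²₊` and `-k_j sin (k·x)` for
`k ∈ -ℤ²₊`. -/
def gradMode (k : Fin 2 → ℤ) (j : Fin 2) (x : Torus) : ℝ :=
  if upperHalf k then (k j : ℝ) * (expMode k x).re else -((k j : ℝ) * (expMode k x).im)

/-- `e_k` as an element of `L²`. -/
def modeL2 (k : Fin 2 → ℤ) : L2 := ContinuousMap.toLp (E := ℝ) 2 volume ℝ (mode k)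

/-- The Fourier coefficient `ŵ_k = (2π)⁻¹ ∫ w(x) exp (-i k·x) dx`, so that
`w = ∑_k ŵ_k (2π)⁻¹ exp (i k·x)`. -/
def fourierMode (w : L2) (k : Fin 2 → ℤ) : ℂ :=
  (2 * Real.pi : ℂ)⁻¹ * ∫ x : Torus, (w x : ℂ) * (starRingEnd ℂ) (expMode k x)

/-- The squared homogeneous Sobolev norm `‖w‖₁² = ∑_k |k|² |ŵ_k|²`, possibly infinite. -/
def sobolevSq (w : L2) : ℝ≥0∞ :=
  ∑' k : Fin 2 → ℤ, ENNReal.ofReal (normSq k * ‖fourierMode w k‖ ^ 2)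

/-! ### The Biot-Savart operator and the nonlinearity -/

/-- The `j`-th component of the velocity `𝒦w`, as an `L²`-convergent Fourier series (its sum is
real almost everywhere): `(𝒦w)^_k = i ŵ_k k^⊥ / |k|²` for `k ≠ 0` and `(𝒦w)^_0 = 0`. This is the
divergence-free, mean-zero field with `∂₂ (𝒦w)₁ - ∂₁ (𝒦w)₂ = w`. -/
def biotSavart (w : L2) (j : Fin 2) : Lp ℂ 2 (volume : Measure Torus) :=
  ∑' k : Fin 2 → ℤ,
    ((2 * Real.pi : ℂ)⁻¹ * (Complex.I * fourierMode w k * (perp k j : ℂ) / (normSq k : ℂ))) •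
      ContinuousMap.toLp (E := ℂ) 2 volume ℂ (expMode k)

/-- The pairing `⟨B(𝒦w, w), e_k⟩`, where `B(u, w) = -(u·∇)w`. As `𝒦w` has no divergence, the
derivative is moved to `e_k`: the pairing is `∫ w (𝒦w·∇e_k) dx`. -/
def advection (w : L2) (k : Fin 2 → ℤ) : ℝ :=
  ∫ x : Torus, w x * ∑ j : Fin 2, (biotSavart w j x).re * gradMode k j x

/-! ### Solutions -/

/-- `w` is the solution path from `w₀` of `∂ₜ w = ν Δw + B(𝒦w, w) + ∂ₜ g` for a given path `g`:
`v = w - g` lies in `C([0,∞); H) ∩ L²_loc([0,∞); V)`, and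
`v(t) = w₀ + ∫₀ᵗ (ν Δw(s) + B(𝒦w(s), w(s))) ds` holds weakly, tested against every `e_k`
(recall `Δ e_k = -|k|² e_k`). -/
structure IsSolutionPath (ν : ℝ) (g : ℝ≥0 → L2) (w₀ : H) (w : ℝ≥0 → H) : Prop where
  initial : w 0 = w₀
  continuous_sub : Continuous fun t => (w t : L2) - g t
  sobolev : ∀ t : ℝ≥0, ∫⁻ s in Set.Icc (0 : ℝ) t,
    sobolevSq ((w s.toNNReal : L2) - g s.toNNReal) < ∞
  weak : ∀ k : Fin 2 → ℤ, k ≠ 0 → ∀ t : ℝ≥0,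
    inner ℝ ((w t : L2) - g t) (modeL2 k) = inner ℝ (w₀ : L2) (modeL2 k) +
      ∫ s in (0 : ℝ)..t, (-(ν * normSq k * inner ℝ (w s.toNNReal : L2) (modeL2 k)) +
        advection (w s.toNNReal : L2) k)

/-- The stochastic process `w` solves the equation driven by the process `η`, with deterministic
initial value `w₀`. -/
structure IsSolution {Ω : Type*} [MeasurableSpace Ω] (P : Measure Ω) (ν : ℝ)
    (η : ℝ≥0 → Ω → L2) (w₀ : H) (w : ℝ≥0 → Ω → H) : Prop where
  aemeasurable : ∀ t, AEMeasurable (w t) P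
  path : ∀ᵐ ω ∂P, IsSolutionPath ν (fun t => η t ω) w₀ (fun t => w t ω)

/-! ### The noise -/

/-- The standing assumption on the set of forced modes: a finite symmetric generator of `ℤ²`
inside `ℤ² \ {0}` with two non-parallel vectors of different length. -/
structure AdmissibleModes (Z : Finset (Fin 2 → ℤ)) : Prop where
  zero_notMem : 0 ∉ Z
  symm : ∀ k ∈ Z, -k ∈ Z
  generates : AddSubgroup.closure (Z : Set (Fin 2 → ℤ)) = ⊤
  nonparallel : ∃ m ∈ Z, ∃ n ∈ Z, m 0 * n 1 ≠ m 1 * n 0 ∧ normSq m ≠ normSq n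

/-- The standing assumption on the Lévy measure of the subordinator, a measure on `(0, ∞)`. -/
structure AdmissibleLevyMeasure (νS : Measure ℝ) : Prop where
  support : νS (Set.Iic 0) = 0
  integrable : ∫⁻ u, ENNReal.ofReal (min 1 u) ∂νS < ∞
  exp_moment : ∃ ζ : ℝ, 0 < ζ ∧ ∫⁻ u, ENNReal.ofReal (Real.exp (ζ * u) - 1) ∂νS < ∞
  infinite : νS (Set.Ioi 0) = ∞

/-- `S` is a pure jump (that is, driftless) subordinator with Lévy measure `νS`: it starts at `0`,
has nondecreasing right-continuous paths (left limits are then automatic) and independent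
increments, and `E exp (-r (S_t - S_s)) = exp (-(t - s) ∫ (1 - exp (-r u)) νS(du))`. -/
structure IsPureJumpSubordinator {Ω : Type*} [MeasurableSpace Ω] (P : Measure Ω)
    (νS : Measure ℝ) (S : ℝ≥0 → Ω → ℝ≥0) : Prop where
  measurable : ∀ t, Measurable (S t)
  zero : ∀ᵐ ω ∂P, S 0 ω = 0
  monotone : ∀ᵐ ω ∂P, Monotone fun t => S t ω
  rightCont : ∀ᵐ ω ∂P, ∀ t, ContinuousWithinAt (fun r => S r ω) (Set.Ici t) t
  indepIncrements : HasIndepIncrements (fun t ω => (S t ω : ℝ)) P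
  laplace : ∀ s t : ℝ≥0, s ≤ t → ∀ r : ℝ, 0 ≤ r →
    ∫ ω, Real.exp (-(r * ((S t ω : ℝ) - S s ω))) ∂P =
      Real.exp (-(((t : ℝ) - s) * ∫ u, (1 - Real.exp (-(r * u))) ∂νS))

/-- `W = (W^k)_{k ∈ Z}` is a standard Brownian motion in `ℝ^Z` and `S` is an independent pure jump
subordinator with Lévy measure `νS`. -/
structure IsNoise {Ω : Type*} [MeasurableSpace Ω] (P : Measure Ω) (Z : Finset (Fin 2 → ℤ))
    (νS : Measure ℝ) (W : Z → ℝ≥0 → Ω → ℝ) (S : ℝ≥0 → Ω → ℝ≥0) : Prop where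
  measurable : ∀ k t, Measurable (W k t)
  brownian : ∀ k, IsBrownianReal (W k) P
  indep : iIndepFun (fun k ω t => W k t ω) P
  subordinator : IsPureJumpSubordinator P νS S
  indep_subordinator : IndepFun (fun ω (q : Z × ℝ≥0) => W q.1 q.2 ω) (fun ω t => S t ω) P

/-- The forcing `η(t) = ∑_{k ∈ Z} b_k W^k_{S_t} e_k`. -/
def forcing {Ω : Type*} {Z : Finset (Fin 2 → ℤ)} (b : Z → ℝ) (W : Z → ℝ≥0 → Ω → ℝ)
    (S : ℝ≥0 → Ω → ℝ≥0) (t : ℝ≥0) (ω : Ω) : L2 :=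
  ∑ k : Z, (b k * W k (S t ω) ω) • modeL2 k

/-- The transition probability `P_t(w₀, A)`: the probability that the solution `w` started
from `w₀` is in `A` at time `t`, that is, the law of `w(t)`. -/
def transitionProb {Ω : Type*} [MeasurableSpace Ω] (P : Measure Ω) (w : ℝ≥0 → Ω → H) (t : ℝ≥0)
    (A : Set H) : ℝ≥0∞ :=
  P.map (w t) A

end

end StochNS

open StochNS

/-!
The idea is that the equation without forcing loses its energy, and that the noise stays negligible
on any given time interval with positive probability. A small forcing does not disturb the decay.

*Deterministic part* (`exists_time_forcing_bound`). Let `v = w - η` and let `D` be the squared norm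
`‖v‖₁²`. Test the equation with the truncation of `v` to finitely many modes. The trilinear form
`∫ φ (𝒦w·∇ψ) dx` is antisymmetric because `𝒦w` has no divergence (`inner_transport_antisymm`), so
of the advection term only two parts remain. One contains the forcing and is at most `K δ (1 + D)`
if the coefficients of `η` are at most `δ`. The other contains the discarded tail of `v`. As
`∑ |k|⁻⁴ < ∞` in dimension two, `‖𝒦w‖_∞ ≤ c ‖w‖₁` (`norm_velocity_le`), so that the tail part is at
most `K ‖tail‖ (1 + D)`, and it vanishes by dominated convergence because `D` is integrable in time.
This gives the energy inequality `‖v(t)‖² + ν ∫ₛᵗ ‖v‖² ≤ ‖v(s)‖² + K δ (t - s)`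
(`exists_energy_inequality`) for every weak solution. The time `T` is chosen so large that `‖v‖²`
has to fall below a small level before `T`; then `δ` is chosen so small that `‖v‖²` stays near this
level until `T`.

*Probabilistic part* (`exists_le_prob_forcing_small`). The forcing is small on `[0, T]` if
`S_T ≤ ε` and if the Brownian motions are small on `[0, ε]`. These two events are independent. The
first has positive probability for every `ε > 0`, because the Laplace exponent of a driftless
subordinator is sublinear (`exists_le_prob_subordinator_le`). The second has probability at least
`1/2` for small `ε`, by a dyadic chaining argument (`exists_prob_brownian_small`). Both bounds are
explicit in the data, hence uniform over all probability spaces and initial values. The possible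
degeneracy of the noise plays no role, as the noise is only required to be small.
-/

open StochNS

namespace StochNS

/-! ### Characters and real modes on the torus -/

lemma expMode_zero : expMode 0 = 1 := by
  ext x
  simp [expMode]

lemma expMode_neg (k : Fin 2 → ℤ) (x : Torus) :
    expMode (-k) x = (starRingEnd ℂ) (expMode k x) := by
  simp only [expMode, ContinuousMap.coe_mk, Pi.neg_apply, fourier_neg, map_prod]

lemma expMode_add (k l : Fin 2 → ℤ) (x : Torus) :
    expMode (k + l) x = expMode k x * expMode l x := by
  simp only [expMode, ContinuousMap.coe_mk, Pi.add_apply, fourier_add, Finset.prod_mul_distrib]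

lemma norm_expMode_apply (k : Fin 2 → ℤ) (x : Torus) : ‖expMode k x‖ = 1 := by
  simp only [expMode, ContinuousMap.coe_mk, fourier_apply, norm_prod, Circle.norm_coe,
    Finset.prod_const_one]

lemma norm_expMode_le (k : Fin 2 → ℤ) : ‖expMode k‖ ≤ 1 :=
  (ContinuousMap.norm_le _ zero_le_one).mpr fun x => (norm_expMode_apply k x).le

lemma integral_fourier_addCircle {T : ℝ} [hT : Fact (0 < T)] (n : ℤ) :
    ∫ x : AddCircle T, fourier n x = if n = 0 then (T : ℂ) else 0 := by
  have h := (orthonormal_iff_ite.mp (@orthonormal_fourier T hT)) 0 n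
  rw [ContinuousMap.inner_toLp] at h
  simp only [fourier_zero, map_one, mul_one] at h
  rw [AddCircle.volume_eq_smul_haarAddCircle, integral_smul_measure, h,
    ENNReal.toReal_ofReal hT.out.le]
  by_cases hn : n = 0
  · simp [hn]
  · simp [hn, Ne.symm hn]

lemma integral_expMode (k : Fin 2 → ℤ) :
    ∫ x : Torus, expMode k x = if k = 0 then (2 * Real.pi : ℂ) ^ 2 else 0 := by
  simp only [expMode, ContinuousMap.coe_mk]
  rw [MeasureTheory.integral_fintype_prod_volume_eq_prod (f := fun j x => fourier (k j) x)]
  simp only [integral_fourier_addCircle]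
  by_cases hk : k = 0
  · simp [hk]
  · obtain ⟨i, hi⟩ := Function.ne_iff.mp hk
    rw [if_neg hk]
    exact Finset.prod_eq_zero (Finset.mem_univ i) (by simpa using hi)

/-- The unimodular factor `α_k` for which `e_k = Re (α_k exp (i k·x))`. -/
noncomputable def phase (k : Fin 2 → ℤ) : ℂ :=
  open Classical in if upperHalf k then -Complex.I else 1

lemma mode_apply (k : Fin 2 → ℤ) (x : Torus) : mode k x = (phase k * expMode k x).re := by
  simp only [mode, phase, ContinuousMap.coe_mk]
  split_ifs <;> simp

lemma gradMode_apply (k : Fin 2 → ℤ) (j : Fin 2) (x : Torus) :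
    gradMode k j x = (Complex.I * (k j : ℂ) * (phase k * expMode k x)).re := by
  simp only [gradMode, phase]
  split_ifs <;> simp

lemma upperHalf_neg_iff {k : Fin 2 → ℤ} (hk : k ≠ 0) : upperHalf (-k) ↔ ¬ upperHalf k := by
  have h : ¬ (k 0 = 0 ∧ k 1 = 0) := fun h => hk (by ext j; fin_cases j <;> simp [h])
  simp only [upperHalf, Pi.neg_apply]
  omega

lemma not_upperHalf_zero : ¬ upperHalf 0 := by simp [upperHalf]

/-- Differentiation turns a sine mode into a multiple of the cosine mode of the opposite wave
vector, and conversely. -/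
lemma gradMode_eq (k : Fin 2 → ℤ) (j : Fin 2) (x : Torus) :
    gradMode k j x = (k j : ℝ) * mode (-k) x := by
  by_cases hk : k = 0
  · simp [hk, gradMode]
  · have h := upperHalf_neg_iff hk
    by_cases hu : upperHalf k <;>
      simp [gradMode, mode, hu, h, expMode_neg]

lemma integrable_continuousMap {E : Type*} [NormedAddCommGroup E] (f : C(Torus, E)) :
    Integrable (fun x => f x) (volume : Measure Torus) :=
  f.continuous.integrable_of_hasCompactSupport (HasCompactSupport.of_compactSpace f)

lemma integral_const_mul_expMode_re (c : ℂ) (k : Fin 2 → ℤ) :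
    ∫ x : Torus, (c * expMode k x).re = if k = 0 then c.re * (2 * Real.pi) ^ 2 else 0 := by
  have hi : Integrable (fun x : Torus => c * expMode k x) :=
    (integrable_continuousMap (expMode k)).const_mul c
  have h := integral_re hi
  simp only [RCLike.re_eq_complex_re] at h
  rw [h, integral_const_mul, integral_expMode]
  split_ifs
  · have : ((2 * Real.pi : ℂ)) ^ 2 = (((2 * Real.pi) ^ 2 : ℝ) : ℂ) := by push_cast; ring
    rw [this, Complex.re_mul_ofReal]
  · simp

lemma inner_toLp_eq (f g : C(Torus, ℝ)) :
    inner ℝ (ContinuousMap.toLp (E := ℝ) 2 (volume : Measure Torus) ℝ f)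
      (ContinuousMap.toLp (E := ℝ) 2 volume ℝ g) = ∫ x, f x * g x := by
  rw [ContinuousMap.inner_toLp]
  simp [mul_comm]

/-- The squared norm of `e_k`, namely `2π²`; for `k = 0`, where `e_0 = 1`, it is `4π²`. -/
noncomputable def modeNormSq (k : Fin 2 → ℤ) : ℝ :=
  if k = 0 then 4 * Real.pi ^ 2 else 2 * Real.pi ^ 2

lemma modeNormSq_pos (k : Fin 2 → ℤ) : 0 < modeNormSq k := by
  unfold modeNormSq; split_ifs <;> positivity

lemma inner_modeL2 (k l : Fin 2 → ℤ) :
    inner ℝ (modeL2 k) (modeL2 l) = if k = l then modeNormSq k else 0 := by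
  rw [modeL2, modeL2, inner_toLp_eq]
  -- `Re a * Re b = (Re (a b) + Re (a conj b)) / 2`
  have hprod : ∀ x : Torus, mode k x * mode l x =
      2⁻¹ * (phase k * phase l * expMode (k + l) x).re +
        2⁻¹ * (phase k * (starRingEnd ℂ) (phase l) * expMode (k + -l) x).re := by
    intro x
    rw [mode_apply, mode_apply, expMode_add, expMode_add, expMode_neg]
    simp only [Complex.mul_re, Complex.mul_im, Complex.conj_re, Complex.conj_im]
    ring
  have hi : ∀ (c : ℂ) (m : Fin 2 → ℤ),
      Integrable (fun x : Torus => 2⁻¹ * (c * expMode m x).re) := fun c m =>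
    (((integrable_continuousMap (expMode m)).const_mul c).re).const_mul _
  simp only [hprod]
  rw [integral_add (hi _ _) (hi _ _), integral_const_mul, integral_const_mul,
    integral_const_mul_expMode_re, integral_const_mul_expMode_re]
  by_cases hkl : k = l
  · subst hkl
    by_cases hk : k = 0
    · subst hk
      simp [phase, not_upperHalf_zero, modeNormSq]
      ring
    · have h2 : k + k ≠ 0 := by
        intro h
        apply hk
        ext j
        have := congrFun h j
        simp at this
        simp
        omega
      have h1 : (phase k * (starRingEnd ℂ) (phase k)).re = 1 := by
        unfold phase; split_ifs <;> simp
      simp only [h2, if_false, add_neg_cancel, if_true, h1, modeNormSq, hk]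
      ring
  · have h1 : k + -l ≠ 0 := by rwa [← sub_eq_add_neg, sub_ne_zero]
    rw [if_neg h1, if_neg hkl]
    by_cases h2 : k + l = 0
    · have hl : l = -k := (neg_eq_of_add_eq_zero_right h2).symm
      have hk : k ≠ 0 := by rintro rfl; exact hkl (by simp [hl])
      have : (phase k * phase l).re = 0 := by
        subst hl
        have h := upperHalf_neg_iff hk
        by_cases hu : upperHalf k <;> simp [phase, hu, h]
      simp [h2, this]
    · simp [h2]

lemma inner_modeL2_self (k : Fin 2 → ℤ) : inner ℝ (modeL2 k) (modeL2 k) = modeNormSq k := by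
  rw [inner_modeL2, if_pos rfl]

/-! ### Completeness of the modes and Parseval's identity -/

lemma separatesPoints_expMode :
    (Algebra.adjoin ℂ (Set.range expMode)).SeparatesPoints := by
  intro x y hxy
  rw [Ne, funext_iff, not_forall] at hxy
  obtain ⟨i, hi⟩ := hxy
  have hs : ∀ z : Torus, expMode (Pi.single i 1) z = fourier 1 (z i) := by
    intro z
    simp only [expMode, ContinuousMap.coe_mk]
    rw [Finset.prod_eq_single i]
    · simp
    · intro j _ hj
      simp [hj]
    · simp
  refine ⟨_, ⟨expMode (Pi.single i 1), Algebra.subset_adjoin ⟨_, rfl⟩, rfl⟩, ?_⟩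
  dsimp only
  rw [hs, hs, fourier_one, fourier_one]
  exact fun h => hi (AddCircle.injective_toCircle Real.two_pi_pos.ne' (Circle.ext h))

/-- Stone-Weierstrass: complex trigonometric polynomials are dense in the continuous functions. -/
lemma span_expMode_dense :
    (Submodule.span ℂ (Set.range expMode)).topologicalClosure = ⊤ := by
  have hspan : (Algebra.adjoin ℂ (Set.range expMode)).toSubmodule =
      Submodule.span ℂ (Set.range expMode) := by
    apply Algebra.adjoin_eq_span_of_subset
    refine .trans (fun x => Submonoid.closure_induction (fun _ => id) ⟨0, expMode_zero⟩ ?_)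
      Submodule.subset_span
    rintro _ _ _ _ ⟨m, rfl⟩ ⟨n, rfl⟩
    exact ⟨m + n, by ext z; exact expMode_add m n z⟩
  let A : StarSubalgebra ℂ C(Torus, ℂ) :=
    { toSubalgebra := Algebra.adjoin ℂ (Set.range expMode)
      star_mem' := by
        change Algebra.adjoin ℂ (Set.range expMode) ≤ star (Algebra.adjoin ℂ (Set.range expMode))
        refine Algebra.adjoin_le ?_
        rintro _ ⟨n, rfl⟩
        refine Algebra.subset_adjoin ⟨-n, ?_⟩
        ext1 x
        simp only [expMode_neg, starRingEnd_apply, ContinuousMap.star_apply] }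
  have hA : A.topologicalClosure = ⊤ :=
    ContinuousMap.starSubalgebra_topologicalClosure_eq_top_of_separatesPoints A
      separatesPoints_expMode
  rw [← hspan]
  exact congr_arg (Subalgebra.toSubmodule <| StarSubalgebra.toSubalgebra ·) hA

/-- The real modes span a dense subspace of the real `L²` space, by taking real parts in the density
of complex trigonometric polynomials. -/
lemma span_modeL2_dense : (Submodule.span ℝ (Set.range modeL2)).topologicalClosure = ⊤ := by
  -- `Φ f` is the class of `Re f` in `L²`; it maps trigonometric polynomials to real ones.
  let re' : C(Torus, ℂ) →L[ℝ] C(Torus, ℝ) := Complex.reCLM.compLeftContinuous ℝ Torus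
  let Φ : C(Torus, ℂ) →L[ℝ] L2 := (ContinuousMap.toLp (E := ℝ) 2 volume ℝ).comp re'
  have hmode : ∀ k (c : ℂ), Φ (c • expMode k) ∈ Submodule.span ℝ (Set.range modeL2) := by
    intro k c
    have key : ∀ k, upperHalf k → ∀ c : ℂ, re' (c • expMode k) =
        c.re • mode (-k) + (-c.im) • mode k := by
      intro k hu c
      have hk : k ≠ 0 := by rintro rfl; exact not_upperHalf_zero hu
      have h := upperHalf_neg_iff hk
      ext x
      simp [re', mode, hu, h, expMode_neg, sub_eq_add_neg]
    have key' : ∃ l m : Fin 2 → ℤ, ∃ a b : ℝ, re' (c • expMode k) = a • mode l + b • mode m := by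
      by_cases hk : k = 0
      · refine ⟨0, 0, c.re, 0, ?_⟩
        ext x
        simp [re', mode, hk, not_upperHalf_zero, expMode_zero]
      · by_cases hu : upperHalf k
        · exact ⟨_, _, _, _, key k hu c⟩
        · have h2 : upperHalf (-k) := (upperHalf_neg_iff hk).2 hu
          refine ⟨k, -k, c.re, c.im, ?_⟩
          ext x
          simp [re', mode, hu, h2, expMode_neg, sub_eq_add_neg]
    obtain ⟨l, m, a, b, h⟩ := key'
    have : Φ (c • expMode k) = a • modeL2 l + b • modeL2 m := by
      change ContinuousMap.toLp (E := ℝ) 2 volume ℝ (re' (c • expMode k)) = _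
      rw [h, map_add, map_smul, map_smul]
      rfl
    rw [this]
    exact add_mem (Submodule.smul_mem _ _ (Submodule.subset_span ⟨l, rfl⟩))
      (Submodule.smul_mem _ _ (Submodule.subset_span ⟨m, rfl⟩))
  have hspan : ∀ f ∈ Submodule.span ℂ (Set.range expMode),
      Φ f ∈ Submodule.span ℝ (Set.range modeL2) := by
    intro f hf
    induction hf using Submodule.closure_induction with
    | zero => simp
    | add f g _ _ hf hg => rw [map_add]; exact add_mem hf hg
    | smul_mem c f hf =>
      obtain ⟨k, rfl⟩ := hf
      exact hmode k c
  have hclos : ∀ f : C(Torus, ℂ),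
      Φ f ∈ (Submodule.span ℝ (Set.range modeL2)).topologicalClosure := by
    intro f
    have hf : f ∈ closure (Submodule.span ℂ (Set.range expMode) : Set C(Torus, ℂ)) := by
      have := span_expMode_dense
      rw [← Submodule.topologicalClosure_coe, this]
      trivial
    exact map_mem_closure Φ.continuous hf fun g hg => hspan g hg
  rw [eq_top_iff]
  intro u _
  have hd := ContinuousMap.toLp_denseRange (p := 2) ℝ (volume : Measure Torus) ℝ
    (by norm_num)
  have hu : u ∈ closure (Set.range (ContinuousMap.toLp (E := ℝ) 2 (volume : Measure Torus) ℝ)) :=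
    hd u
  refine closure_minimal ?_ (Submodule.isClosed_topologicalClosure _) hu
  rintro _ ⟨f, rfl⟩
  have hf : f = re' ((Complex.ofRealCLM.compLeftContinuous ℝ Torus) f) := by
    ext x
    simp [re']
  rw [hf]
  exact hclos _

lemma orthonormal_modeL2 : Orthonormal ℝ fun k => (√(modeNormSq k))⁻¹ • modeL2 k := by
  rw [orthonormal_iff_ite]
  intro k l
  rw [real_inner_smul_left, real_inner_smul_right, inner_modeL2]
  split_ifs with h
  · subst h
    have := modeNormSq_pos k
    have h2 : √(modeNormSq k) ≠ 0 := (Real.sqrt_pos.2 this).ne'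
    field_simp
    rw [Real.sq_sqrt this.le]
  · simp

/-- The normalised modes as a Hilbert basis of the real `L²` space. -/
noncomputable def modeBasis : HilbertBasis (Fin 2 → ℤ) ℝ L2 :=
  HilbertBasis.mk orthonormal_modeL2 (by
    rw [top_le_iff, ← span_modeL2_dense]
    congr 1
    apply le_antisymm
    · rw [Submodule.span_le]
      rintro _ ⟨k, rfl⟩
      exact Submodule.smul_mem _ _ (Submodule.subset_span ⟨k, rfl⟩)
    · rw [Submodule.span_le]
      rintro _ ⟨k, rfl⟩
      have h2 : √(modeNormSq k) ≠ 0 := (Real.sqrt_pos.2 (modeNormSq_pos k)).ne'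
      have : modeL2 k = √(modeNormSq k) • ((√(modeNormSq k))⁻¹ • modeL2 k) := by
        rw [smul_smul, mul_inv_cancel₀ h2, one_smul]
      rw [this]
      exact Submodule.smul_mem _ _ (Submodule.subset_span ⟨k, rfl⟩))

lemma modeBasis_apply (k : Fin 2 → ℤ) : modeBasis k = (√(modeNormSq k))⁻¹ • modeL2 k := by
  simp [modeBasis]

lemma inner_modeBasis (u : L2) (k : Fin 2 → ℤ) :
    inner ℝ (modeBasis k) u = (√(modeNormSq k))⁻¹ * inner ℝ u (modeL2 k) := by
  rw [modeBasis_apply, real_inner_smul_left, real_inner_comm]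

lemma inner_modeBasis_sq (u : L2) (k : Fin 2 → ℤ) :
    inner ℝ (modeBasis k) u * inner ℝ (modeBasis k) u =
      inner ℝ u (modeL2 k) ^ 2 / modeNormSq k := by
  rw [inner_modeBasis]
  have := modeNormSq_pos k
  have h2 : √(modeNormSq k) ≠ 0 := (Real.sqrt_pos.2 this).ne'
  field_simp
  rw [Real.sq_sqrt this.le]
  field_simp

/-- Parseval's identity for the real modes. -/
lemma hasSum_inner_sq (u : L2) :
    HasSum (fun k => inner ℝ u (modeL2 k) ^ 2 / modeNormSq k) (‖u‖ ^ 2) := by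
  have h := modeBasis.hasSum_inner_mul_inner u u
  rw [real_inner_self_eq_norm_sq] at h
  refine h.congr_fun ?_
  intro k
  rw [← inner_modeBasis_sq, real_inner_comm (modeBasis k) u]

lemma hasSum_modes (u : L2) :
    HasSum (fun k => (inner ℝ u (modeL2 k) / modeNormSq k) • modeL2 k) u := by
  have h := modeBasis.hasSum_repr u
  refine h.congr_fun ?_
  intro k
  rw [HilbertBasis.repr_apply_apply, inner_modeBasis, modeBasis_apply, smul_smul]
  congr 1
  have := modeNormSq_pos k
  have h2 : √(modeNormSq k) ≠ 0 := (Real.sqrt_pos.2 this).ne'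
  field_simp
  rw [Real.sq_sqrt this.le]

lemma norm_sum_smul_modeL2_sq (F : Finset (Fin 2 → ℤ)) (a : (Fin 2 → ℤ) → ℝ) :
    ‖∑ k ∈ F, a k • modeL2 k‖ ^ 2 = ∑ k ∈ F, modeNormSq k * a k ^ 2 := by
  rw [← real_inner_self_eq_norm_sq, sum_inner]
  refine Finset.sum_congr rfl fun k hk => ?_
  rw [real_inner_smul_left, inner_sum, Finset.sum_eq_single k]
  · rw [real_inner_smul_right, inner_modeL2_self]
    ring
  · intro l _ hl
    rw [real_inner_smul_right, inner_modeL2, if_neg (Ne.symm hl), mul_zero]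
  · intro h; exact absurd hk h

/-! ### The Sobolev norm through the real modes -/

lemma integral_mul_eq_inner (u : L2) (f : C(Torus, ℝ)) :
    ∫ x, u x * f x = inner ℝ u (ContinuousMap.toLp (E := ℝ) 2 volume ℝ f) := by
  rw [MeasureTheory.L2.inner_def]
  refine integral_congr_ae ?_
  filter_upwards [ContinuousMap.coeFn_toLp (p := 2) (𝕜 := ℝ) (volume : Measure Torus) f] with x hx
  rw [hx]
  simp [mul_comm]

/-- The real part of a complex-valued continuous function. -/
noncomputable def reMap (f : C(Torus, ℂ)) : C(Torus, ℝ) := ⟨fun x => (f x).re, by fun_prop⟩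

/-- The imaginary part of a complex-valued continuous function. -/
noncomputable def imMap (f : C(Torus, ℂ)) : C(Torus, ℝ) := ⟨fun x => (f x).im, by fun_prop⟩

lemma fourierMode_eq (u : L2) (k : Fin 2 → ℤ) :
    fourierMode u k = (2 * Real.pi : ℂ)⁻¹ *
      ((inner ℝ u (ContinuousMap.toLp (E := ℝ) 2 volume ℝ (reMap (expMode k))) : ℝ) -
        (inner ℝ u (ContinuousMap.toLp (E := ℝ) 2 volume ℝ (imMap (expMode k))) : ℝ) *
          Complex.I) := by
  have hu : Integrable (fun x => u x) (volume : Measure Torus) :=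
    (Lp.memLp u).integrable (by norm_num)
  have hi : Integrable (fun x : Torus => (u x : ℂ) * (starRingEnd ℂ) (expMode k x)) := by
    refine (hu.ofReal (𝕜 := ℂ)).mul_bdd (c := 1) (by fun_prop) ?_
    filter_upwards with x
    simp [norm_expMode_apply]
  rw [fourierMode, ← integral_mul_eq_inner, ← integral_mul_eq_inner]
  congr 1
  apply Complex.ext
  · have := integral_re hi
    simp only [RCLike.re_eq_complex_re] at this
    rw [← this]
    simp [reMap]
  · have := integral_im hi
    simp only [RCLike.im_eq_complex_im] at this
    rw [← this]
    simp [imMap, integral_neg]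

lemma norm_fourierMode_sq (u : L2) {k : Fin 2 → ℤ} (hk : k ≠ 0) :
    ‖fourierMode u k‖ ^ 2 = (4 * Real.pi ^ 2)⁻¹ *
      (inner ℝ u (modeL2 k) ^ 2 + inner ℝ u (modeL2 (-k)) ^ 2) := by
  have hn : ∀ a b : ℝ, ‖(2 * Real.pi : ℂ)⁻¹ * ((a : ℂ) - b * Complex.I)‖ ^ 2 =
      (4 * Real.pi ^ 2)⁻¹ * (a ^ 2 + b ^ 2) := by
    intro a b
    have h1 : ((a : ℂ) - b * Complex.I) = ⟨a, -b⟩ := by apply Complex.ext <;> simp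
    have h2 : (2 * Real.pi : ℂ)⁻¹ = (((2 * Real.pi)⁻¹ : ℝ) : ℂ) := by push_cast; rfl
    rw [norm_mul, mul_pow, h1, h2, Complex.norm_real, Complex.sq_norm, Complex.normSq_mk,
      Real.norm_eq_abs, sq_abs]
    ring
  rw [fourierMode_eq, hn]
  have h := upperHalf_neg_iff hk
  by_cases hu : upperHalf k
  · have h1 : reMap (expMode k) = mode (-k) := by ext x; simp [reMap, mode, hu, h, expMode_neg]
    have h2 : imMap (expMode k) = mode k := by ext x; simp [imMap, mode, hu]
    rw [h1, h2]
    change _ * (inner ℝ u (modeL2 (-k)) ^ 2 + inner ℝ u (modeL2 k) ^ 2) = _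
    ring
  · have h1 : reMap (expMode k) = mode k := by ext x; simp [reMap, mode, hu]
    have h2 : imMap (expMode k) = -mode (-k) := by
      ext x; simp [imMap, mode, hu, h, expMode_neg]
    rw [h1, h2, map_neg, inner_neg_right]
    change _ * (inner ℝ u (modeL2 k) ^ 2 + (-inner ℝ u (modeL2 (-k))) ^ 2) = _
    ring

lemma normSq_nonneg (k : Fin 2 → ℤ) : 0 ≤ normSq k := by unfold normSq; positivity

lemma normSq_zero : normSq 0 = 0 := by simp [normSq]

lemma normSq_neg (k : Fin 2 → ℤ) : normSq (-k) = normSq k := by simp [normSq]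

lemma one_le_normSq {k : Fin 2 → ℤ} (hk : k ≠ 0) : 1 ≤ normSq k := by
  have h : ¬ (k 0 = 0 ∧ k 1 = 0) := fun h => hk (by ext j; fin_cases j <;> simp [h])
  have h2 : (1 : ℤ) ≤ k 0 ^ 2 + k 1 ^ 2 := by
    by_contra hlt
    apply h
    constructor <;> nlinarith [sq_nonneg (k 0), sq_nonneg (k 1)]
  unfold normSq
  exact_mod_cast h2

/-- The squared Sobolev norm in terms of the real modes, with `⟨u, e_k⟩ / (2π²)` the coefficient
of `e_k`. -/
lemma sobolevSq_eq (u : L2) :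
    sobolevSq u = ∑' k, ENNReal.ofReal (normSq k * inner ℝ u (modeL2 k) ^ 2 /
      (2 * Real.pi ^ 2)) := by
  have hq : ∀ k, ENNReal.ofReal (normSq k * ‖fourierMode u k‖ ^ 2) =
      ENNReal.ofReal (normSq k * inner ℝ u (modeL2 k) ^ 2 / (4 * Real.pi ^ 2)) +
      ENNReal.ofReal (normSq (-k) * inner ℝ u (modeL2 (-k)) ^ 2 / (4 * Real.pi ^ 2)) := by
    intro k
    rw [← ENNReal.ofReal_add
      (div_nonneg (mul_nonneg (normSq_nonneg _) (sq_nonneg _)) (by positivity))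
      (div_nonneg (mul_nonneg (normSq_nonneg _) (sq_nonneg _)) (by positivity))]
    congr 1
    by_cases hk : k = 0
    · simp [hk, normSq_zero]
    · rw [norm_fourierMode_sq u hk, normSq_neg]
      ring
  unfold sobolevSq
  simp only [hq]
  have hneg := (Equiv.neg (Fin 2 → ℤ)).tsum_eq
    (fun k => ENNReal.ofReal (normSq k * inner ℝ u (modeL2 k) ^ 2 / (4 * Real.pi ^ 2)))
  simp only [Equiv.neg_apply] at hneg
  rw [ENNReal.tsum_add, hneg, ← ENNReal.tsum_add]
  refine tsum_congr fun k => ?_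
  rw [← ENNReal.ofReal_add
      (div_nonneg (mul_nonneg (normSq_nonneg _) (sq_nonneg _)) (by positivity))
      (div_nonneg (mul_nonneg (normSq_nonneg _) (sq_nonneg _)) (by positivity))]
  congr 1
  ring

lemma sobolev_term_nonneg (u : L2) (k : Fin 2 → ℤ) :
    0 ≤ normSq k * inner ℝ u (modeL2 k) ^ 2 / (2 * Real.pi ^ 2) :=
  div_nonneg (mul_nonneg (normSq_nonneg _) (sq_nonneg _)) (by positivity)

lemma hasSum_sobolevSq {u : L2} (hu : sobolevSq u ≠ ∞) :
    HasSum (fun k => normSq k * inner ℝ u (modeL2 k) ^ 2 / (2 * Real.pi ^ 2))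
      (sobolevSq u).toReal := by
  rw [sobolevSq_eq] at hu ⊢
  have h := ENNReal.hasSum_toReal hu
  rw [← ENNReal.tsum_toReal_eq fun k => ENNReal.ofReal_ne_top] at h
  refine HasSum.congr_fun h ?_
  intro k
  rw [ENNReal.toReal_ofReal (sobolev_term_nonneg u k)]

lemma measurable_sobolevSq_comp {X : ℝ → L2} (hX : Continuous X) :
    Measurable fun s => sobolevSq (X s) := by
  simp only [sobolevSq_eq]
  refine Measurable.tsum fun k => ?_
  refine ENNReal.measurable_ofReal.comp (Continuous.measurable ?_)
  fun_prop

lemma sobolevSq_add_le (u v : L2) : sobolevSq (u + v) ≤ 2 * sobolevSq u + 2 * sobolevSq v := by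
  simp only [sobolevSq_eq]
  rw [← ENNReal.tsum_mul_left, ← ENNReal.tsum_mul_left, ← ENNReal.tsum_add]
  refine ENNReal.tsum_le_tsum fun k => ?_
  have h2 : ∀ x : ℝ, 2 * ENNReal.ofReal x = ENNReal.ofReal (2 * x) := fun x => by
    rw [ENNReal.ofReal_mul (by norm_num), ENNReal.ofReal_ofNat]
  rw [h2, h2, ← ENNReal.ofReal_add (mul_nonneg (by norm_num) (sobolev_term_nonneg u k))
      (mul_nonneg (by norm_num) (sobolev_term_nonneg v k))]
  apply ENNReal.ofReal_le_ofReal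
  rw [inner_add_left, ← mul_div_assoc, ← mul_div_assoc, ← add_div]
  refine div_le_div_of_nonneg_right ?_ (by positivity)
  nlinarith [mul_nonneg (normSq_nonneg k)
    (sq_nonneg (inner ℝ u (modeL2 k) - inner ℝ v (modeL2 k)))]

/-- Poincaré's inequality. -/
lemma norm_sq_le_sobolevSq {u : L2} (hu : sobolevSq u ≠ ∞) (h0 : inner ℝ u (modeL2 0) = 0) :
    ‖u‖ ^ 2 ≤ (sobolevSq u).toReal := by
  refine hasSum_le (fun k => ?_) (hasSum_inner_sq u) (hasSum_sobolevSq hu)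
  by_cases hk : k = 0
  · simp [hk, h0, normSq_zero]
  · rw [modeNormSq, if_neg hk]
    refine div_le_div_of_nonneg_right ?_ (by positivity)
    nlinarith [one_le_normSq hk, sq_nonneg (inner ℝ u (modeL2 k))]

lemma mem_H_iff (u : L2) : u ∈ H ↔ inner ℝ u (modeL2 0) = 0 := by
  have : inner ℝ u (modeL2 0) = ∫ x, u x := by
    rw [modeL2, ← integral_mul_eq_inner]
    simp [mode, not_upperHalf_zero, expMode_zero]
  rw [this]
  rfl

/-! ### The velocity field of a vorticity in `V` -/

/-- The coefficient of `exp (i k·x)` in the `j`-th component of the velocity field `𝒦w`. -/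
noncomputable def velCoef (w : L2) (j : Fin 2) (k : Fin 2 → ℤ) : ℂ :=
  (2 * Real.pi : ℂ)⁻¹ * (Complex.I * fourierMode w k * (perp k j : ℂ) / (normSq k : ℂ))

lemma abs_perp_le (k : Fin 2 → ℤ) (j : Fin 2) : |(perp k j : ℝ)| ≤ √(normSq k) := by
  apply Real.abs_le_sqrt
  fin_cases j <;> simp [perp, normSq] <;> positivity

lemma norm_velCoef_le (w : L2) (j : Fin 2) (k : Fin 2 → ℤ) :
    ‖velCoef w j k‖ ≤ (√(normSq k) * ‖fourierMode w k‖) * (normSq k)⁻¹ := by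
  have h1 : ‖(2 * Real.pi : ℂ)⁻¹‖ ≤ 1 := by
    have : (2 * Real.pi : ℂ)⁻¹ = (((2 * Real.pi)⁻¹ : ℝ) : ℂ) := by push_cast; rfl
    rw [this, Complex.norm_real, Real.norm_eq_abs, abs_of_pos (by positivity)]
    exact inv_le_one_of_one_le₀ (by linarith [Real.pi_gt_three])
  have h2 : ‖((normSq k : ℝ) : ℂ)‖ = normSq k := by
    rw [Complex.norm_real, Real.norm_eq_abs, abs_of_nonneg (normSq_nonneg k)]
  have h3 : ‖((perp k j : ℤ) : ℂ)‖ ≤ √(normSq k) := by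
    rw [← Complex.ofReal_intCast, Complex.norm_real]
    exact abs_perp_le k j
  have hinv : 0 ≤ (normSq k)⁻¹ := inv_nonneg.2 (normSq_nonneg k)
  rw [velCoef, norm_mul, norm_div, norm_mul, norm_mul, Complex.norm_I, one_mul, h2, div_eq_mul_inv]
  calc ‖(2 * Real.pi : ℂ)⁻¹‖ * (‖fourierMode w k‖ * ‖((perp k j : ℤ) : ℂ)‖ * (normSq k)⁻¹)
      ≤ 1 * (‖fourierMode w k‖ * √(normSq k) * (normSq k)⁻¹) := by gcongr
    _ = _ := by ring

/-- `∑ |k|⁻⁴` converges in dimension two (the term `k = 0` is `0⁻¹ = 0`). -/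
lemma summable_normSq_inv_sq : Summable fun k : Fin 2 → ℤ => ((normSq k)⁻¹) ^ 2 := by
  refine Summable.of_nonneg_of_le (fun k => by positivity) (fun k => ?_)
    (EisensteinSeries.summable_one_div_norm_rpow (k := 4) (by norm_num))
  by_cases hk : k = 0
  · simp [hk, normSq_zero]
  · have hpos : 0 < ‖k‖ := norm_pos_iff.2 hk
    have h1 : ‖k‖ ^ 2 ≤ normSq k := by
      have h : ‖k‖ ≤ √(normSq k) := by
        refine (pi_norm_le_iff_of_nonneg (Real.sqrt_nonneg _)).2 fun j => ?_
        rw [Int.norm_eq_abs]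
        apply Real.abs_le_sqrt
        fin_cases j <;> simp [normSq] <;> positivity
      calc ‖k‖ ^ 2 ≤ √(normSq k) ^ 2 := by gcongr
        _ = normSq k := Real.sq_sqrt (normSq_nonneg k)
    rw [Real.rpow_neg hpos.le, show ((4 : ℝ)) = ((4 : ℕ) : ℝ) by norm_num, Real.rpow_natCast,
      inv_pow]
    apply inv_anti₀ (by positivity)
    calc ‖k‖ ^ 4 = (‖k‖ ^ 2) ^ 2 := by ring
      _ ≤ normSq k ^ 2 := by gcongr

/-- The constant in the embedding `‖𝒦w‖_∞ ≤ c ‖w‖₁`. -/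
noncomputable def velConst : ℝ := √(∑' k : Fin 2 → ℤ, ((normSq k)⁻¹) ^ 2)

lemma velConst_nonneg : 0 ≤ velConst := Real.sqrt_nonneg _

lemma sum_norm_velCoef_le {w : L2} (hw : sobolevSq w ≠ ∞) (j : Fin 2)
    (F : Finset (Fin 2 → ℤ)) :
    ∑ k ∈ F, ‖velCoef w j k‖ ≤ velConst * √(sobolevSq w).toReal := by
  have hs : HasSum (fun k => normSq k * ‖fourierMode w k‖ ^ 2) (sobolevSq w).toReal := by
    unfold sobolevSq at hw ⊢
    have h := ENNReal.hasSum_toReal hw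
    rw [← ENNReal.tsum_toReal_eq fun k => ENNReal.ofReal_ne_top] at h
    refine HasSum.congr_fun h fun k => ?_
    rw [ENNReal.toReal_ofReal (mul_nonneg (normSq_nonneg _) (sq_nonneg _))]
  calc ∑ k ∈ F, ‖velCoef w j k‖
      ≤ ∑ k ∈ F, (√(normSq k) * ‖fourierMode w k‖) * (normSq k)⁻¹ :=
        Finset.sum_le_sum fun k _ => norm_velCoef_le w j k
    _ ≤ √(∑ k ∈ F, (√(normSq k) * ‖fourierMode w k‖) ^ 2) * √(∑ k ∈ F, ((normSq k)⁻¹) ^ 2) :=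
        Real.sum_mul_le_sqrt_mul_sqrt _ _ _
    _ ≤ √(sobolevSq w).toReal * velConst := by
        gcongr
        · calc ∑ k ∈ F, (√(normSq k) * ‖fourierMode w k‖) ^ 2
              = ∑ k ∈ F, normSq k * ‖fourierMode w k‖ ^ 2 := by
                refine Finset.sum_congr rfl fun k _ => ?_
                rw [mul_pow, Real.sq_sqrt (normSq_nonneg k)]
            _ ≤ _ := sum_le_hasSum F
                (fun k _ => mul_nonneg (normSq_nonneg _) (sq_nonneg _)) hs
        · exact Real.sqrt_le_sqrt
            (summable_normSq_inv_sq.sum_le_tsum F fun k _ => by positivity)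
    _ = _ := mul_comm _ _

lemma summable_norm_velCoef {w : L2} (hw : sobolevSq w ≠ ∞) (j : Fin 2) :
    Summable fun k => ‖velCoef w j k‖ :=
  summable_of_sum_le (fun _ => norm_nonneg _) (sum_norm_velCoef_le hw j)

lemma norm_velCoef_smul_le (w : L2) (j : Fin 2) (k : Fin 2 → ℤ) :
    ‖velCoef w j k • expMode k‖ ≤ ‖velCoef w j k‖ := by
  rw [norm_smul]
  exact mul_le_of_le_one_right (norm_nonneg _) (norm_expMode_le k)

/-- The velocity field as a uniformly convergent Fourier series. -/
noncomputable def velocity (w : L2) (j : Fin 2) : C(Torus, ℂ) :=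
  ∑' k, velCoef w j k • expMode k

lemma hasSum_velocity {w : L2} (hw : sobolevSq w ≠ ∞) (j : Fin 2) :
    HasSum (fun k => velCoef w j k • expMode k) (velocity w j) :=
  (Summable.of_norm_bounded (summable_norm_velCoef hw j) (norm_velCoef_smul_le w j)).hasSum

lemma norm_velocity_le {w : L2} (hw : sobolevSq w ≠ ∞) (j : Fin 2) :
    ‖velocity w j‖ ≤ velConst * √(sobolevSq w).toReal :=
  (tsum_of_norm_bounded (summable_norm_velCoef hw j).hasSum (norm_velCoef_smul_le w j)).trans
    ((summable_norm_velCoef hw j).tsum_le_of_sum_le (sum_norm_velCoef_le hw j))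

lemma biotSavart_eq_toLp {w : L2} (hw : sobolevSq w ≠ ∞) (j : Fin 2) :
    biotSavart w j = ContinuousMap.toLp (E := ℂ) 2 volume ℂ (velocity w j) := by
  have h := (hasSum_velocity hw j).mapL (ContinuousMap.toLp (E := ℂ) 2 (volume : Measure Torus) ℂ)
  rw [← h.tsum_eq]
  simp only [map_smul]
  rfl

/-! ### The advection term as a bilinear pairing -/

/-- The function `U·∇e_k`, for a continuous vector field `U`. -/
noncomputable def transport (U : Fin 2 → C(Torus, ℝ)) (k : Fin 2 → ℤ) : L2 :=
  ContinuousMap.toLp (E := ℝ) 2 volume ℝ (∑ j, (k j : ℝ) • (U j * mode (-k)))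

/-- The velocity field as a real continuous vector field. -/
noncomputable def reVelocity (w : L2) (j : Fin 2) : C(Torus, ℝ) := reMap (velocity w j)

lemma norm_reMap_le (f : C(Torus, ℂ)) : ‖reMap f‖ ≤ ‖f‖ :=
  (ContinuousMap.norm_le _ (norm_nonneg _)).2 fun x =>
    (Complex.abs_re_le_norm _).trans (f.norm_coe_le_norm x)

lemma advection_eq_inner {w : L2} (hw : sobolevSq w ≠ ∞) (k : Fin 2 → ℤ) :
    advection w k = inner ℝ w (transport (reVelocity w) k) := by
  rw [transport, ← integral_mul_eq_inner, advection]
  refine integral_congr_ae ?_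
  have h : ∀ j, biotSavart w j =ᵐ[volume] velocity w j := fun j => by
    rw [biotSavart_eq_toLp hw j]
    exact ContinuousMap.coeFn_toLp _ _
  filter_upwards [h 0, h 1] with x h0 h1
  simp only [Fin.sum_univ_two, h0, h1, gradMode_eq]
  simp [reVelocity, reMap]
  left
  ring

lemma norm_mul_toLp_le (f g : C(Torus, ℝ)) :
    ‖ContinuousMap.toLp (E := ℝ) 2 (volume : Measure Torus) ℝ (f * g)‖ ≤
      ‖f‖ * ‖ContinuousMap.toLp (E := ℝ) 2 (volume : Measure Torus) ℝ g‖ := by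
  refine Lp.norm_le_mul_norm_of_ae_le_mul ?_
  filter_upwards [ContinuousMap.coeFn_toLp (p := 2) (𝕜 := ℝ) (volume : Measure Torus) (f * g),
    ContinuousMap.coeFn_toLp (p := 2) (𝕜 := ℝ) (volume : Measure Torus) g] with x h1 h2
  rw [h1, h2, ContinuousMap.mul_apply, norm_mul]
  gcongr
  exact f.norm_coe_le_norm x

lemma norm_sum_smul_transport_le {U : Fin 2 → C(Torus, ℝ)} {M : ℝ} (hU : ∀ j, ‖U j‖ ≤ M)
    (F : Finset (Fin 2 → ℤ)) (a : (Fin 2 → ℤ) → ℝ) :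
    ‖∑ k ∈ F, a k • transport U k‖ ≤
      2 * M * √(2 * Real.pi ^ 2 * ∑ k ∈ F, normSq k * a k ^ 2) := by
  have hM : 0 ≤ M := (norm_nonneg _).trans (hU 0)
  have hsum : ∑ k ∈ F, a k • transport U k = ∑ j : Fin 2,
      ContinuousMap.toLp (E := ℝ) 2 (volume : Measure Torus) ℝ
        (U j * ∑ k ∈ F, (a k * k j) • mode (-k)) := by
    rw [← map_sum]
    simp only [transport, ← map_smul]
    rw [← map_sum]
    congr 1
    simp only [Finset.mul_sum, Finset.smul_sum]
    rw [Finset.sum_comm]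
    refine Finset.sum_congr rfl fun j _ => Finset.sum_congr rfl fun k _ => ?_
    rw [smul_smul, mul_smul_comm]
  have hj : ∀ j : Fin 2, ‖ContinuousMap.toLp (E := ℝ) 2 (volume : Measure Torus) ℝ
        (U j * ∑ k ∈ F, (a k * k j) • mode (-k))‖ ≤
      M * √(2 * Real.pi ^ 2 * ∑ k ∈ F, normSq k * a k ^ 2) := by
    intro j
    refine (norm_mul_toLp_le _ _).trans (mul_le_mul (hU j) ?_ (norm_nonneg _) hM)
    apply Real.le_sqrt_of_sq_le
    have h1 : ContinuousMap.toLp (E := ℝ) 2 (volume : Measure Torus) ℝ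
        (∑ k ∈ F, (a k * k j) • mode (-k)) =
        ∑ k ∈ F.image (fun k => -k), (a (-k) * (-k) j) • modeL2 k := by
      rw [Finset.sum_image (fun x _ y _ h => neg_injective h), map_sum]
      simp only [map_smul, neg_neg]
      rfl
    rw [h1, norm_sum_smul_modeL2_sq, Finset.sum_image (fun x _ y _ h => neg_injective h),
      Finset.mul_sum]
    refine Finset.sum_le_sum fun k _ => ?_
    by_cases hk : k = 0
    · simp [hk, normSq_zero]
    have hk0 : -k ≠ 0 := neg_ne_zero.2 hk
    rw [modeNormSq, if_neg hk0, neg_neg, mul_pow]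
    have h2 : ((k j : ℤ) : ℝ) ^ 2 ≤ normSq k := by
      fin_cases j <;> simp [normSq] <;> positivity
    have : a k ^ 2 * ((k j : ℤ) : ℝ) ^ 2 ≤ normSq k * a k ^ 2 := by
      rw [mul_comm]
      gcongr
    gcongr
  rw [hsum]
  refine (norm_sum_le _ _).trans ?_
  rw [Fin.sum_univ_two]
  linarith [hj 0, hj 1]

/-! ### Incompressibility -/

lemma integral_velocity_mul_expMode {w : L2} (hw : sobolevSq w ≠ ∞) (j : Fin 2)
    (m : Fin 2 → ℤ) :
    ∫ x, velocity w j x * expMode m x = (2 * Real.pi : ℂ) ^ 2 * velCoef w j (-m) := by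
  let L : C(Torus, ℂ) →L[ℂ] ℂ :=
    (innerSL ℂ (ContinuousMap.toLp (E := ℂ) 2 (volume : Measure Torus) ℂ (expMode (-m)))).comp
      (ContinuousMap.toLp (E := ℂ) 2 volume ℂ)
  have hL : ∀ f, L f = ∫ x, f x * expMode m x := by
    intro f
    simp only [L, ContinuousLinearMap.comp_apply, innerSL_apply_apply]
    rw [ContinuousMap.inner_toLp]
    simp only [expMode_neg, Complex.conj_conj]
  have h := (hasSum_velocity hw j).mapL L
  have hval : ∀ k, L (velCoef w j k • expMode k) =
      if k = -m then (2 * Real.pi : ℂ) ^ 2 * velCoef w j (-m) else 0 := by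
    intro k
    rw [map_smul, hL]
    simp only [← expMode_add]
    rw [integral_expMode, smul_eq_mul]
    by_cases hk : k = -m
    · subst hk
      simp [mul_comm]
    · have : k + m ≠ 0 := fun h => hk (eq_neg_of_add_eq_zero_left h)
      simp [hk, this]
  simp only [hval] at h
  rw [← hL]
  exact (h.unique (hasSum_ite_eq _ _))

lemma sum_mul_velCoef (w : L2) (m : Fin 2 → ℤ) :
    ∑ j, (m j : ℂ) * velCoef w j m = 0 := by
  simp [Fin.sum_univ_two, velCoef, perp]
  ring

/-- The velocity field is orthogonal to gradients of trigonometric polynomials. -/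
lemma integral_reVelocity_mul_gradient {w : L2} (hw : sobolevSq w ≠ ∞) (m : Fin 2 → ℤ) (c : ℂ) :
    ∫ x, ∑ j, reVelocity w j x * (Complex.I * (m j : ℂ) * c * expMode m x).re = 0 := by
  have hre : ∀ (j : Fin 2) (x : Torus),
      reVelocity w j x * (Complex.I * (m j : ℂ) * c * expMode m x).re =
        2⁻¹ * (Complex.I * (m j : ℂ) * c * (velocity w j x * expMode m x)).re +
        2⁻¹ * ((starRingEnd ℂ) (Complex.I * (m j : ℂ) * c) *
          (velocity w j x * expMode (-m) x)).re := by
    intro j x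
    generalize hz : Complex.I * (m j : ℂ) * c = z
    rw [expMode_neg]
    simp only [reVelocity, reMap, ContinuousMap.coe_mk, Complex.mul_re, Complex.mul_im,
      Complex.conj_re, Complex.conj_im]
    ring
  have hi : ∀ (j : Fin 2) (n : Fin 2 → ℤ) (z : ℂ),
      Integrable (fun x : Torus => z * (velocity w j x * expMode n x)) := fun j n z =>
    (integrable_continuousMap (velocity w j * expMode n)).const_mul z
  have hval : ∀ (j : Fin 2) (n : Fin 2 → ℤ) (z : ℂ),
      ∫ x : Torus, 2⁻¹ * (z * (velocity w j x * expMode n x)).re =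
        2⁻¹ * (z * ((2 * Real.pi : ℂ) ^ 2 * velCoef w j (-n))).re := by
    intro j n z
    have h := integral_re (hi j n z)
    simp only [RCLike.re_eq_complex_re] at h
    rw [integral_const_mul, h, integral_const_mul, integral_velocity_mul_expMode hw]
  have hi2 : ∀ (j : Fin 2) (n : Fin 2 → ℤ) (z : ℂ),
      Integrable (fun x : Torus => 2⁻¹ * (z * (velocity w j x * expMode n x)).re) := fun j n z =>
    (hi j n z).re.const_mul _
  simp only [hre]
  have hsum := integral_finsetSum (μ := (volume : Measure Torus)) Finset.univ
    fun j _ => (hi2 j m (Complex.I * (m j : ℂ) * c)).add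
      (hi2 j (-m) ((starRingEnd ℂ) (Complex.I * (m j : ℂ) * c)))
  simp only [Pi.add_apply] at hsum
  rw [hsum]
  have hj : ∀ j : Fin 2, ∫ x : Torus,
      (2⁻¹ * (Complex.I * (m j : ℂ) * c * (velocity w j x * expMode m x)).re +
        2⁻¹ * ((starRingEnd ℂ) (Complex.I * (m j : ℂ) * c) *
          (velocity w j x * expMode (-m) x)).re) =
      (2⁻¹ * (Complex.I * c * (2 * Real.pi : ℂ) ^ 2 * ((m j : ℂ) * velCoef w j (-m)))).re +
      (2⁻¹ * ((starRingEnd ℂ) (Complex.I * c) * (2 * Real.pi : ℂ) ^ 2 *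
        ((m j : ℂ) * velCoef w j m))).re := by
    intro j
    rw [integral_add (hi2 _ _ _) (hi2 _ _ _), hval, hval, neg_neg]
    have h2 : ∀ z : ℂ, 2⁻¹ * z.re = (2⁻¹ * z).re := fun z => by simp
    rw [h2, h2]
    simp only [map_mul, Complex.conj_I, map_intCast]
    congr 2 <;> ring
  simp only [hj]
  rw [Finset.sum_add_distrib, ← Complex.re_sum, ← Complex.re_sum, ← Finset.mul_sum,
    ← Finset.mul_sum, ← Finset.mul_sum, ← Finset.mul_sum, sum_mul_velCoef]
  have : ∑ j, (m j : ℂ) * velCoef w j (-m) = 0 := by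
    have h := sum_mul_velCoef w (-m)
    simp only [Pi.neg_apply, Int.cast_neg, neg_mul, Finset.sum_neg_distrib, neg_eq_zero] at h
    exact h
  rw [this]
  simp

/-- Antisymmetry of the trilinear form `∫ φ (𝒦w·∇ψ) dx` on the modes, from
`φ ∇ψ + ψ ∇φ = ∇(φψ)`. -/
lemma inner_transport_antisymm {w : L2} (hw : sobolevSq w ≠ ∞) (k l : Fin 2 → ℤ) :
    inner ℝ (modeL2 k) (transport (reVelocity w) l) +
      inner ℝ (modeL2 l) (transport (reVelocity w) k) = 0 := by
  have hadd := integral_add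
    (integrable_continuousMap (mode k * ∑ j, (l j : ℝ) • (reVelocity w j * mode (-l))))
    (integrable_continuousMap (mode l * ∑ j, (k j : ℝ) • (reVelocity w j * mode (-k))))
  simp only [ContinuousMap.mul_apply] at hadd
  rw [modeL2, modeL2, transport, transport, inner_toLp_eq, inner_toLp_eq, ← hadd]
  have hx : ∀ x : Torus,
      mode k x * (∑ j, (l j : ℝ) • (reVelocity w j * mode (-l))) x +
        mode l x * (∑ j, (k j : ℝ) • (reVelocity w j * mode (-k))) x =
      ∑ j, reVelocity w j x * (Complex.I * ((k + l) j : ℤ) * (2⁻¹ * (phase k * phase l)) *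
        expMode (k + l) x).re +
      ∑ j, reVelocity w j x * (Complex.I * ((l + -k) j : ℤ) *
        (2⁻¹ * ((starRingEnd ℂ) (phase k) * phase l)) * expMode (l + -k) x).re := by
    intro x
    have hg : ∀ (n : Fin 2 → ℤ), (∑ j, (n j : ℝ) • (reVelocity w j * mode (-n))) x =
        ∑ j, reVelocity w j x * (Complex.I * (n j : ℂ) * (phase n * expMode n x)).re := by
      intro n
      simp only [← gradMode_apply, gradMode_eq]
      simp [Fin.sum_univ_two]
      ring
    rw [hg, hg, Finset.mul_sum, Finset.mul_sum, ← Finset.sum_add_distrib,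
      ← Finset.sum_add_distrib]
    refine Finset.sum_congr rfl fun j _ => ?_
    rw [mode_apply, mode_apply, expMode_add, expMode_add, expMode_neg]
    have e1 : ∀ a b c d : ℂ, ∀ p q : ℤ, Complex.I * ((p + q : ℤ) : ℂ) * (2⁻¹ * (a * b)) * (c * d) =
        (2⁻¹ : ℝ) * (Complex.I * ((p + q : ℤ) : ℂ) * ((a * c) * (b * d))) := by
      intros; push_cast; ring
    have e2 : Complex.I * ((l + -k) j : ℤ) *
        (2⁻¹ * ((starRingEnd ℂ) (phase k) * phase l)) *
          (expMode l x * (starRingEnd ℂ) (expMode k x)) =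
        (2⁻¹ : ℝ) * (Complex.I * ((l j - k j : ℤ) : ℂ) * ((starRingEnd ℂ) (phase k * expMode k x) *
          (phase l * expMode l x))) := by
      simp only [Pi.add_apply, Pi.neg_apply, map_mul]
      push_cast
      ring
    rw [e2, Pi.add_apply, e1]
    generalize phase k * expMode k x = a
    generalize phase l * expMode l x = b
    rw [Complex.re_ofReal_mul, Complex.re_ofReal_mul]
    simp only [Complex.mul_re, Complex.mul_im, Complex.I_re, Complex.I_im, Complex.intCast_re,
      Complex.intCast_im, Complex.conj_re, Complex.conj_im]
    push_cast
    ring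
  simp only [hx]
  rw [integral_add, integral_reVelocity_mul_gradient hw, integral_reVelocity_mul_gradient hw,
    add_zero]
  · exact Continuous.integrable_of_hasCompactSupport (by fun_prop)
      (HasCompactSupport.of_compactSpace _)
  · exact Continuous.integrable_of_hasCompactSupport (by fun_prop)
      (HasCompactSupport.of_compactSpace _)

/-! ### The Galerkin energy balance at a fixed time -/

lemma inner_sum_smul_modeL2 {Z : Finset (Fin 2 → ℤ)} (hZ : 0 ∉ Z) (c : (Fin 2 → ℤ) → ℝ)
    (k : Fin 2 → ℤ) :
    inner ℝ (∑ z ∈ Z, c z • modeL2 z) (modeL2 k) = if k ∈ Z then 2 * Real.pi ^ 2 * c k else 0 := by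
  rw [sum_inner]
  simp only [real_inner_smul_left, inner_modeL2, mul_ite, mul_zero]
  rw [Finset.sum_ite_eq' Z k]
  by_cases hk : k ∈ Z
  · have : k ≠ 0 := fun h => hZ (h ▸ hk)
    simp [hk, modeNormSq, this, mul_comm]
  · simp [hk]

lemma sobolevSq_sum_smul_le {Z : Finset (Fin 2 → ℤ)} (hZ : 0 ∉ Z) {c : (Fin 2 → ℤ) → ℝ} {δ : ℝ}
    (hc : ∀ z ∈ Z, |c z| ≤ δ) :
    sobolevSq (∑ z ∈ Z, c z • modeL2 z) ≤
      ENNReal.ofReal (2 * Real.pi ^ 2 * (∑ z ∈ Z, normSq z) * δ ^ 2) := by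
  rw [sobolevSq_eq, tsum_eq_sum (s := Z)]
  · rw [← ENNReal.ofReal_sum_of_nonneg fun k _ => sobolev_term_nonneg _ k]
    apply ENNReal.ofReal_le_ofReal
    rw [Finset.mul_sum, Finset.sum_mul]
    refine Finset.sum_le_sum fun k hk => ?_
    rw [inner_sum_smul_modeL2 hZ, if_pos hk]
    have h1 : c k ^ 2 ≤ δ ^ 2 := sq_le_sq' (by linarith [abs_le.1 (hc k hk)]) (abs_le.1 (hc k hk)).2
    have hpi : (0 : ℝ) < Real.pi ^ 2 := by positivity
    calc normSq k * (2 * Real.pi ^ 2 * c k) ^ 2 / (2 * Real.pi ^ 2)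
        = 2 * Real.pi ^ 2 * normSq k * c k ^ 2 := by field_simp
      _ ≤ 2 * Real.pi ^ 2 * normSq k * δ ^ 2 := by
        have := normSq_nonneg k
        gcongr
  · intro k hk
    rw [inner_sum_smul_modeL2 hZ, if_neg hk]
    simp

/-- The Fourier truncation of `v` to the modes in `F`. -/
noncomputable def truncation (v : L2) (F : Finset (Fin 2 → ℤ)) : L2 :=
  ∑ k ∈ F, (inner ℝ v (modeL2 k) / modeNormSq k) • modeL2 k

lemma tendsto_truncation (v : L2) :
    Filter.Tendsto (fun F => ‖v - truncation v F‖) Filter.atTop (nhds 0) := by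
  have h : Filter.Tendsto (truncation v) Filter.atTop (nhds v) := hasSum_modes v
  have h2 := (tendsto_const_nhds (x := v)).sub h
  rw [sub_self] at h2
  simpa using h2.norm

lemma norm_truncation_sq (v : L2) (F : Finset (Fin 2 → ℤ)) :
    ‖truncation v F‖ ^ 2 = ∑ k ∈ F, inner ℝ v (modeL2 k) ^ 2 / modeNormSq k := by
  rw [truncation, norm_sum_smul_modeL2_sq]
  refine Finset.sum_congr rfl fun k _ => ?_
  have := (modeNormSq_pos k).ne'
  field_simp

lemma norm_truncation_le (v : L2) (F : Finset (Fin 2 → ℤ)) : ‖truncation v F‖ ≤ ‖v‖ := by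
  rw [← sq_le_sq₀ (norm_nonneg _) (norm_nonneg _), norm_truncation_sq]
  exact sum_le_hasSum F (fun k _ => div_nonneg (sq_nonneg _) (modeNormSq_pos k).le)
    (hasSum_inner_sq v)

lemma norm_sub_truncation_le (v : L2) (F : Finset (Fin 2 → ℤ)) :
    ‖v - truncation v F‖ ≤ 2 * ‖v‖ := by
  linarith [norm_sub_le v (truncation v F), norm_truncation_le v F]

/-- The trilinear form vanishes when its two scalar arguments agree. -/
lemma inner_sum_transport_eq_zero {w : L2} (hw : sobolevSq w ≠ ∞) (F : Finset (Fin 2 → ℤ))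
    (a : (Fin 2 → ℤ) → ℝ) :
    inner ℝ (∑ k ∈ F, a k • modeL2 k) (∑ k ∈ F, a k • transport (reVelocity w) k) = 0 := by
  have h : inner ℝ (∑ k ∈ F, a k • modeL2 k) (∑ k ∈ F, a k • transport (reVelocity w) k) =
      ∑ k ∈ F, ∑ l ∈ F, a k * a l * inner ℝ (modeL2 k) (transport (reVelocity w) l) := by
    rw [sum_inner]
    refine Finset.sum_congr rfl fun k _ => ?_
    rw [inner_sum]
    refine Finset.sum_congr rfl fun l _ => ?_
    rw [real_inner_smul_left, real_inner_smul_right]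
    ring
  have h2 := h
  rw [Finset.sum_comm] at h2
  have h3 : ∑ k ∈ F, ∑ l ∈ F, a k * a l * inner ℝ (modeL2 k) (transport (reVelocity w) l) +
      ∑ k ∈ F, ∑ l ∈ F, a l * a k * inner ℝ (modeL2 l) (transport (reVelocity w) k) = 0 := by
    rw [← Finset.sum_add_distrib]
    refine Finset.sum_eq_zero fun k _ => ?_
    rw [← Finset.sum_add_distrib]
    refine Finset.sum_eq_zero fun l _ => ?_
    have := inner_transport_antisymm hw k l
    rw [mul_comm (a l) (a k), ← mul_add, this, mul_zero]
  rw [← h, ← h2] at h3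
  linarith

lemma inner_sum_transport_swap {w : L2} (hw : sobolevSq w ≠ ∞) (Z F : Finset (Fin 2 → ℤ))
    (a c : (Fin 2 → ℤ) → ℝ) :
    inner ℝ (∑ z ∈ Z, c z • modeL2 z) (∑ k ∈ F, a k • transport (reVelocity w) k) =
      - inner ℝ (∑ k ∈ F, a k • modeL2 k) (∑ z ∈ Z, c z • transport (reVelocity w) z) := by
  have h : ∀ (F Z : Finset (Fin 2 → ℤ)) (a c : (Fin 2 → ℤ) → ℝ),
      inner ℝ (∑ k ∈ F, a k • modeL2 k) (∑ z ∈ Z, c z • transport (reVelocity w) z) =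
      ∑ k ∈ F, ∑ z ∈ Z, a k * c z * inner ℝ (modeL2 k) (transport (reVelocity w) z) := by
    intro F Z a c
    rw [sum_inner]
    refine Finset.sum_congr rfl fun k _ => ?_
    rw [inner_sum]
    refine Finset.sum_congr rfl fun l _ => ?_
    rw [real_inner_smul_left, real_inner_smul_right]
    ring
  rw [h, h, Finset.sum_comm, ← Finset.sum_neg_distrib]
  refine Finset.sum_congr rfl fun k _ => ?_
  rw [← Finset.sum_neg_distrib]
  refine Finset.sum_congr rfl fun z _ => ?_
  have := inner_transport_antisymm hw k z
  linear_combination c z * a k * this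

/-- A weighted Cauchy-Schwarz inequality. -/
lemma neg_sum_weighted_le {ι : Type*} {F : Finset ι} {n q e : ι → ℝ} (hn : ∀ k ∈ F, 0 ≤ n k)
    {P N δ A : ℝ} (hP : 0 < P) (hN : 0 ≤ N) (hδ : 0 ≤ δ) (hA : 1 ≤ A)
    (h1 : P * ∑ k ∈ F, n k * q k ^ 2 ≤ A) (h2 : (∑ k ∈ F, n k * e k ^ 2) / P ≤ N * δ ^ 2) :
    - ∑ k ∈ F, q k * (n k * e k) ≤ √N * δ * A := by
  have hcs : (∑ k ∈ F, q k * (n k * e k)) ^ 2 ≤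
      (∑ k ∈ F, n k * q k ^ 2) * ∑ k ∈ F, n k * e k ^ 2 := by
    have h := Finset.sum_mul_sq_le_sq_mul_sq F (fun k => √(n k) * q k) (fun k => √(n k) * e k)
    have e1 : ∑ k ∈ F, (√(n k) * q k) * (√(n k) * e k) = ∑ k ∈ F, q k * (n k * e k) := by
      refine Finset.sum_congr rfl fun k hk => ?_
      linear_combination (q k * e k) * Real.mul_self_sqrt (hn k hk)
    have e2 : ∀ f : ι → ℝ, ∑ k ∈ F, (√(n k) * f k) ^ 2 = ∑ k ∈ F, n k * f k ^ 2 := fun f => by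
      refine Finset.sum_congr rfl fun k hk => ?_
      rw [mul_pow, Real.sq_sqrt (hn k hk)]
    rwa [e1, e2, e2] at h
  have hy0 : 0 ≤ ∑ k ∈ F, n k * e k ^ 2 :=
    Finset.sum_nonneg fun k hk => mul_nonneg (hn k hk) (sq_nonneg _)
  have hprod : (∑ k ∈ F, n k * q k ^ 2) * ∑ k ∈ F, n k * e k ^ 2 ≤ A * (N * δ ^ 2) := by
    calc (∑ k ∈ F, n k * q k ^ 2) * ∑ k ∈ F, n k * e k ^ 2
        = (P * ∑ k ∈ F, n k * q k ^ 2) * ((∑ k ∈ F, n k * e k ^ 2) / P) := by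
          field_simp
      _ ≤ A * (N * δ ^ 2) := by gcongr
  refine (neg_le_abs _).trans (abs_le_of_sq_le_sq ?_ (by positivity))
  calc (∑ k ∈ F, q k * (n k * e k)) ^ 2 ≤ A * (N * δ ^ 2) := hcs.trans hprod
    _ ≤ A ^ 2 * (N * δ ^ 2) := by
      gcongr
      nlinarith
    _ = (√N * δ * A) ^ 2 := by
      rw [mul_pow, mul_pow, Real.sq_sqrt hN]
      ring

/-- The right-hand side of the equation tested against `e_k`. -/
noncomputable def driftMode (ν : ℝ) (w : L2) (k : Fin 2 → ℤ) : ℝ :=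
  -(ν * normSq k * inner ℝ w (modeL2 k)) + advection w k

/-- The energy production of `v = w - η` in the modes `F`: viscous dissipation, an error that is
small with the forcing `η`, and an error that disappears as `F` grows. -/
lemma galerkin_energy_bound {ν : ℝ} (hν : 0 ≤ ν) {Z : Finset (Fin 2 → ℤ)} (hZ : 0 ∉ Z) :
    ∃ K : ℝ, 0 ≤ K ∧ ∀ (v : L2), sobolevSq v ≠ ∞ → inner ℝ v (modeL2 0) = 0 →
      ∀ (δ : ℝ), 0 ≤ δ → δ ≤ 1 → ∀ c : (Fin 2 → ℤ) → ℝ, (∀ z ∈ Z, |c z| ≤ δ) →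
      ∀ F : Finset (Fin 2 → ℤ),
      2 * ∑ k ∈ F, inner ℝ v (modeL2 k) / modeNormSq k *
          driftMode ν (v + ∑ z ∈ Z, c z • modeL2 z) k ≤
        -(2 * ν * ∑ k ∈ F, normSq k * inner ℝ v (modeL2 k) ^ 2 / (2 * Real.pi ^ 2)) +
        K * δ * (1 + (sobolevSq v).toReal) +
        K * ‖v - truncation v F‖ * (1 + (sobolevSq v).toReal) := by
  set N : ℝ := 2 * Real.pi ^ 2 * ∑ z ∈ Z, normSq z with hN
  have hN0 : 0 ≤ N := by
    have : 0 ≤ ∑ z ∈ Z, normSq z := Finset.sum_nonneg fun z _ => normSq_nonneg z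
    positivity
  set L : ℝ := 2 + 2 * N with hL
  have hV := velConst_nonneg
  refine ⟨4 * velConst * √L * (1 + √N) + 2 * ν * √N, by positivity, ?_⟩
  intro v hv hv0 δ hδ0 hδ1 c hc F
  set η : L2 := ∑ z ∈ Z, c z • modeL2 z with hη
  set w : L2 := v + η with hw_def
  set D : ℝ := (sobolevSq v).toReal with hD
  have hD0 : 0 ≤ D := ENNReal.toReal_nonneg
  set q : (Fin 2 → ℤ) → ℝ := fun k => inner ℝ v (modeL2 k) / modeNormSq k with hq
  have hηS : sobolevSq η ≤ ENNReal.ofReal (N * δ ^ 2) := sobolevSq_sum_smul_le hZ hc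
  have hηtop : sobolevSq η ≠ ∞ := ne_top_of_le_ne_top ENNReal.ofReal_ne_top hηS
  have hηD : (sobolevSq η).toReal ≤ N * δ ^ 2 := ENNReal.toReal_le_of_le_ofReal (by positivity) hηS
  have hwS := sobolevSq_add_le v η
  have hmul : ∀ x : ℝ≥0∞, x ≠ ∞ → 2 * x ≠ ∞ := fun x hx => ENNReal.mul_ne_top (by norm_num) hx
  have hw : sobolevSq w ≠ ∞ :=
    ne_top_of_le_ne_top (ENNReal.add_ne_top.2 ⟨hmul _ hv, hmul _ hηtop⟩) hwS
  have hwD : (sobolevSq w).toReal ≤ L * (1 + D) := by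
    have h := ENNReal.toReal_mono (ENNReal.add_ne_top.2 ⟨hmul _ hv, hmul _ hηtop⟩) hwS
    rw [ENNReal.toReal_add (hmul _ hv) (hmul _ hηtop), ENNReal.toReal_mul, ENNReal.toReal_mul] at h
    simp only [ENNReal.toReal_ofNat] at h
    have hδ2 : δ ^ 2 ≤ 1 := pow_le_one₀ hδ0 hδ1
    nlinarith [mul_le_mul_of_nonneg_left hδ2 hN0, mul_nonneg hN0 hD0]
  set M : ℝ := velConst * √L * √(1 + D) with hM
  have hU : ∀ j, ‖reVelocity w j‖ ≤ M := by
    intro j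
    calc ‖reVelocity w j‖ ≤ ‖velocity w j‖ := norm_reMap_le _
      _ ≤ velConst * √(sobolevSq w).toReal := norm_velocity_le hw j
      _ ≤ velConst * √(L * (1 + D)) := by gcongr
      _ = M := by rw [Real.sqrt_mul (by positivity), hM, mul_assoc]
  have hM0 : 0 ≤ M := by positivity
  set G : L2 := ∑ k ∈ F, q k • transport (reVelocity w) k with hG
  set G' : L2 := ∑ z ∈ Z, c z • transport (reVelocity w) z with hG'
  -- the coefficient at `k = 0` vanishes, so that `modeNormSq k` may be taken to be `2π²`
  have hqk : ∀ k, 2 * Real.pi ^ 2 * (normSq k * q k ^ 2) =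
      normSq k * inner ℝ v (modeL2 k) ^ 2 / (2 * Real.pi ^ 2) := by
    intro k
    by_cases hk : k = 0
    · simp [hk, normSq_zero]
    · simp only [hq, modeNormSq, if_neg hk]
      have hpi : Real.pi ≠ 0 := Real.pi_ne_zero
      field_simp
  have hDF : 2 * Real.pi ^ 2 * ∑ k ∈ F, normSq k * q k ^ 2 ≤ D := by
    rw [Finset.mul_sum, Finset.sum_congr rfl fun k _ => hqk k]
    exact sum_le_hasSum F (fun k _ => sobolev_term_nonneg v k) (hasSum_sobolevSq hv)
  have hsD : √(1 + D) * √(1 + D) = 1 + D := Real.mul_self_sqrt (by positivity)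
  have hsDle : √(1 + D) ≤ 1 + D := by
    have h1 : 1 ≤ √(1 + D) := Real.one_le_sqrt.2 (by linarith)
    nlinarith
  have hGn : ‖G‖ ≤ 2 * M * √(1 + D) := by
    refine (norm_sum_smul_transport_le hU F q).trans ?_
    gcongr
    linarith
  have hG'n : ‖G'‖ ≤ 2 * M * (√N * δ) := by
    refine (norm_sum_smul_transport_le hU Z c).trans ?_
    gcongr
    rw [← Real.sqrt_sq hδ0, ← Real.sqrt_mul hN0]
    apply Real.sqrt_le_sqrt
    rw [hN, mul_assoc (2 * Real.pi ^ 2) _ (δ ^ 2)]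
    refine mul_le_mul_of_nonneg_left ?_ (show (0 : ℝ) ≤ 2 * Real.pi ^ 2 by positivity)
    rw [Finset.sum_mul]
    refine Finset.sum_le_sum fun z hz => ?_
    have h1 : c z ^ 2 ≤ δ ^ 2 :=
      sq_le_sq' (by linarith [abs_le.1 (hc z hz)]) (abs_le.1 (hc z hz)).2
    exact mul_le_mul_of_nonneg_left h1 (normSq_nonneg z)
  have hvF : ‖truncation v F‖ ≤ √(1 + D) := by
    refine (norm_truncation_le v F).trans (Real.le_sqrt_of_sq_le ?_)
    linarith [norm_sq_le_sobolevSq hv hv0]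
  -- the nonlinear term
  have hadv : ∑ k ∈ F, q k * advection w k = inner ℝ w G := by
    rw [hG, inner_sum]
    refine Finset.sum_congr rfl fun k _ => ?_
    rw [real_inner_smul_right, advection_eq_inner hw]
  have hsplit : inner ℝ w G = inner ℝ (v - truncation v F) G - inner ℝ (truncation v F) G' := by
    have h1 : inner ℝ (truncation v F) G = 0 := inner_sum_transport_eq_zero hw F q
    have h2 : inner ℝ η G = - inner ℝ (truncation v F) G' := inner_sum_transport_swap hw Z F q c
    rw [inner_sub_left, h1, hw_def, inner_add_left, h2]
    ring
  have hnl1 : inner ℝ (v - truncation v F) G ≤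
      ‖v - truncation v F‖ * (2 * velConst * √L * (1 + D)) := by
    refine (real_inner_le_norm _ _).trans ?_
    gcongr
    refine hGn.trans (le_of_eq ?_)
    rw [hM]
    linear_combination (2 * velConst * √L) * hsD
  have hnl2 : - inner ℝ (truncation v F) G' ≤ 2 * velConst * √L * √N * δ * (1 + D) := by
    refine (neg_le_abs _).trans ((abs_real_inner_le_norm _ _).trans ?_)
    calc ‖truncation v F‖ * ‖G'‖ ≤ √(1 + D) * (2 * M * (√N * δ)) := by gcongr
      _ = _ := by
        rw [hM]
        linear_combination (2 * velConst * √L * √N * δ) * hsD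
  -- the linear term
  have hlin : - ∑ k ∈ F, q k * (normSq k * inner ℝ η (modeL2 k)) ≤ √N * δ * (1 + D) := by
    refine neg_sum_weighted_le (n := normSq) (q := q) (e := fun k => inner ℝ η (modeL2 k))
      (fun k _ => normSq_nonneg k) (show (0 : ℝ) < 2 * Real.pi ^ 2 by positivity) hN0 hδ0
      (by linarith) (by linarith) ?_
    refine le_trans (le_of_eq ?_) ((sum_le_hasSum F (fun k _ => sobolev_term_nonneg η k)
      (hasSum_sobolevSq hηtop)).trans hηD)
    rw [Finset.sum_div]
  have hexp : ∑ k ∈ F, q k * driftMode ν w k =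
      -(ν * ∑ k ∈ F, normSq k * inner ℝ v (modeL2 k) ^ 2 / (2 * Real.pi ^ 2)) +
        ν * (- ∑ k ∈ F, q k * (normSq k * inner ℝ η (modeL2 k))) + inner ℝ w G := by
    rw [← hadv, Finset.mul_sum, ← Finset.sum_neg_distrib, ← Finset.sum_neg_distrib,
      Finset.mul_sum, ← Finset.sum_add_distrib, ← Finset.sum_add_distrib]
    refine Finset.sum_congr rfl fun k _ => ?_
    rw [driftMode, hw_def, inner_add_left, ← hqk]
    have hAq : normSq k * inner ℝ v (modeL2 k) = normSq k * (2 * Real.pi ^ 2 * q k) := by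
      by_cases hk : k = 0
      · simp [hk, normSq_zero]
      · simp only [hq, modeNormSq, if_neg hk]
        have hpi : Real.pi ≠ 0 := Real.pi_ne_zero
        field_simp
    linear_combination (-(q k * ν)) * hAq
  change 2 * ∑ k ∈ F, q k * driftMode ν w k ≤ _
  rw [hexp, hsplit]
  have hlin' := mul_le_mul_of_nonneg_left hlin hν
  have hR := norm_nonneg (v - truncation v F)
  have hx1 : 0 ≤ 4 * velConst * √L * δ * (1 + D) := by positivity
  have hx2 : 0 ≤ (4 * velConst * √L * √N + 2 * ν * √N) * ‖v - truncation v F‖ * (1 + D) := by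
    positivity
  nlinarith

/-! ### Measurability of the drift along a path -/

/-- The pairing `⟨w, Re (z e_l) e_{-k}⟩`, written so that measurability in `w` and `z` is plain. -/
noncomputable def rePairing (w : L2) (z : ℂ) (l k : Fin 2 → ℤ) : ℝ :=
  z.re * inner ℝ w (ContinuousMap.toLp (E := ℝ) 2 volume ℝ (reMap (expMode l) * mode (-k))) -
    z.im * inner ℝ w (ContinuousMap.toLp (E := ℝ) 2 volume ℝ (imMap (expMode l) * mode (-k)))

lemma advection_eq_tsum {w : L2} (hw : sobolevSq w ≠ ∞) (k : Fin 2 → ℤ) :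
    advection w k = ∑ j, (k j : ℝ) * ∑' l, rePairing w (velCoef w j l) l k := by
  let reL : C(Torus, ℂ) →L[ℝ] C(Torus, ℝ) := Complex.reCLM.compLeftContinuous ℝ Torus
  let mulL : C(Torus, ℝ) →L[ℝ] C(Torus, ℝ) :=
    (ContinuousLinearMap.mul ℝ C(Torus, ℝ)).flip (mode (-k))
  let L : C(Torus, ℂ) →L[ℝ] ℝ :=
    (innerSL ℝ w).comp ((ContinuousMap.toLp (E := ℝ) 2 volume ℝ).comp (mulL.comp reL))
  have hL : ∀ f, L f =
      inner ℝ w (ContinuousMap.toLp (E := ℝ) 2 volume ℝ (reMap f * mode (-k))) := fun f => rfl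
  have hterm : ∀ j l, L (velCoef w j l • expMode l) = rePairing w (velCoef w j l) l k := by
    intro j l
    have h : reMap (velCoef w j l • expMode l) * mode (-k) =
        (velCoef w j l).re • (reMap (expMode l) * mode (-k)) -
          (velCoef w j l).im • (imMap (expMode l) * mode (-k)) := by
      ext x
      simp [reMap, imMap]
      ring
    rw [hL, h, map_sub, map_smul, map_smul, inner_sub_right, real_inner_smul_right,
      real_inner_smul_right, rePairing]
  rw [advection_eq_inner hw, transport, map_sum, inner_sum]
  refine Finset.sum_congr rfl fun j _ => ?_
  rw [map_smul, real_inner_smul_right]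
  congr 1
  have h := (hasSum_velocity hw j).mapL L
  simp only [hterm] at h
  rw [h.tsum_eq, hL]
  rfl

lemma measurable_velCoef_comp {w : ℝ → L2}
    (hw : ∀ h : L2, Measurable fun s => (inner ℝ (w s) h : ℝ)) (j : Fin 2) (l : Fin 2 → ℤ) :
    Measurable fun s => velCoef (w s) j l := by
  unfold velCoef
  simp only [fourierMode_eq]
  have h1 := hw (ContinuousMap.toLp (E := ℝ) 2 volume ℝ (reMap (expMode l)))
  have h2 := hw (ContinuousMap.toLp (E := ℝ) 2 volume ℝ (imMap (expMode l)))
  fun_prop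

lemma aemeasurable_driftMode {w : ℝ → L2}
    (hw : ∀ h : L2, Measurable fun s => (inner ℝ (w s) h : ℝ)) {T : ℝ}
    (hfin : ∀ᵐ s ∂volume.restrict (Set.Icc 0 T), sobolevSq (w s) ≠ ∞) (ν : ℝ) (k : Fin 2 → ℤ) :
    AEMeasurable (fun s => driftMode ν (w s) k) (volume.restrict (Set.Icc 0 T)) := by
  have hm : Measurable fun s => -(ν * normSq k * inner ℝ (w s) (modeL2 k)) +
      ∑ j, (k j : ℝ) * ∑' l, rePairing (w s) (velCoef (w s) j l) l k := by
    refine Measurable.add ((hw _).const_mul _).neg (Finset.measurable_fun_sum _ fun j _ =>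
      Measurable.const_mul (Measurable.tsum fun l => ?_) _)
    unfold rePairing
    have h := measurable_velCoef_comp hw j l
    exact ((Complex.measurable_re.comp h).mul (hw _)).sub
      ((Complex.measurable_im.comp h).mul (hw _))
  refine ⟨_, hm, ?_⟩
  filter_upwards [hfin] with s hs
  rw [driftMode, advection_eq_tsum hs]

/-- The drift in one mode is bounded by a multiple of `‖w‖ (1 + ‖w‖₁²)`, so it is integrable in time
along paths in `C([0, T]; H) ∩ L²([0, T]; V)`. -/
lemma abs_driftMode_le {ν : ℝ} (hν : 0 ≤ ν) {w : L2} (hw : sobolevSq w ≠ ∞) (k : Fin 2 → ℤ) :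
    |driftMode ν w k| ≤ (ν * normSq k * ‖modeL2 k‖ +
      2 * velConst * √(2 * Real.pi ^ 2 * normSq k)) * ‖w‖ * (1 + (sobolevSq w).toReal) := by
  have hV := velConst_nonneg
  have hn := normSq_nonneg k
  have hD : 0 ≤ (sobolevSq w).toReal := ENNReal.toReal_nonneg
  have hU : ∀ j, ‖reVelocity w j‖ ≤ velConst * √(sobolevSq w).toReal := fun j =>
    (norm_reMap_le _).trans (norm_velocity_le hw j)
  have htr : ‖transport (reVelocity w) k‖ ≤
      2 * (velConst * √(sobolevSq w).toReal) * √(2 * Real.pi ^ 2 * normSq k) := by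
    simpa using norm_sum_smul_transport_le hU {k} (fun _ => 1)
  have hs : √(sobolevSq w).toReal ≤ 1 + (sobolevSq w).toReal := by
    rw [Real.sqrt_le_left (by positivity)]
    nlinarith
  have h1 : |ν * normSq k * inner ℝ w (modeL2 k)| ≤
      ν * normSq k * ‖modeL2 k‖ * ‖w‖ * (1 + (sobolevSq w).toReal) := by
    rw [abs_mul, abs_of_nonneg (by positivity)]
    calc ν * normSq k * |inner ℝ w (modeL2 k)| ≤ ν * normSq k * (‖w‖ * ‖modeL2 k‖) := by
          gcongr
          exact abs_real_inner_le_norm _ _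
      _ = ν * normSq k * ‖modeL2 k‖ * ‖w‖ * 1 := by ring
      _ ≤ _ := by
          gcongr
          linarith
  have h2 : |advection w k| ≤ 2 * velConst * √(2 * Real.pi ^ 2 * normSq k) * ‖w‖ *
      (1 + (sobolevSq w).toReal) := by
    rw [advection_eq_inner hw]
    calc |inner ℝ w (transport (reVelocity w) k)|
        ≤ ‖w‖ * ‖transport (reVelocity w) k‖ := abs_real_inner_le_norm _ _
      _ ≤ ‖w‖ * (2 * (velConst * √(sobolevSq w).toReal) * √(2 * Real.pi ^ 2 * normSq k)) := by
          gcongr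
      _ ≤ ‖w‖ * (2 * (velConst * (1 + (sobolevSq w).toReal)) *
            √(2 * Real.pi ^ 2 * normSq k)) := by gcongr
      _ = _ := by ring
  rw [driftMode]
  refine (abs_add_le _ _).trans ?_
  rw [abs_neg]
  linarith

/-- The square of a primitive of an integrable function is the primitive of `2 y f`. -/
lemma sq_sub_sq_eq_integral {f y : ℝ → ℝ} {T : ℝ} (hf : IntervalIntegrable f volume 0 T)
    (hy : ∀ t ∈ Set.Icc 0 T, y t = y 0 + ∫ s in (0 : ℝ)..t, f s) {s t : ℝ} (hs : 0 ≤ s)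
    (hst : s ≤ t) (ht : t ≤ T) :
    y t ^ 2 - y s ^ 2 = ∫ r in s..t, 2 * (y r * f r) := by
  have hT : 0 ≤ T := hs.trans (hst.trans ht)
  have hsub : Set.uIcc s t ⊆ Set.uIcc 0 T := by
    rw [Set.uIcc_of_le hst, Set.uIcc_of_le hT]
    exact Set.Icc_subset_Icc hs ht
  set Y : ℝ → ℝ := fun t => y 0 + ∫ s in (0 : ℝ)..t, f s with hY
  have hac : AbsolutelyContinuousOnInterval Y s t := by
    have h0 := hf.absolutelyContinuousOnInterval_intervalIntegral (c := 0) (by simp)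
    have hc : AbsolutelyContinuousOnInterval (fun _ : ℝ => y 0) 0 T :=
      (LipschitzWith.const (y 0)).lipschitzOnWith.absolutelyContinuousOnInterval
    exact (hc.fun_add h0).mono hsub
  have hder : ∀ᵐ x, x ∈ Set.uIcc 0 T → HasDerivAt Y (f x) x := by
    filter_upwards [hf.ae_hasDerivAt_integral] with x hx hxm
    exact (hx hxm 0 (by simp)).const_add _
  have hYy : ∀ r ∈ Set.Icc s t, Y r = y r := fun r hr => (hy r ⟨hs.trans hr.1, hr.2.trans ht⟩).symm
  have h := hac.integral_deriv_mul_eq_sub hac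
  rw [hYy s ⟨le_rfl, hst⟩, hYy t ⟨hst, le_rfl⟩] at h
  rw [pow_two, pow_two, ← h]
  refine intervalIntegral.integral_congr_ae ?_
  filter_upwards [hder] with x hx hxm
  have hxI : x ∈ Set.uIcc s t := Set.uIoc_subset_uIcc hxm
  rw [(hx (hsub hxI)).deriv, hYy x (by rwa [Set.uIcc_of_le hst] at hxI)]
  ring

/-! ### The energy inequality along a path with small forcing -/

lemma intervalIntegrable_of_integrableOn {f : ℝ → ℝ} {T s t : ℝ}
    (hf : IntegrableOn f (Set.Icc 0 T)) (hs : 0 ≤ s) (hst : s ≤ t) (ht : t ≤ T) :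
    IntervalIntegrable f volume s t := by
  rw [intervalIntegrable_iff_integrableOn_Ioc_of_le hst]
  exact hf.mono_set (Set.Ioc_subset_Icc_self.trans (Set.Icc_subset_Icc hs ht))

/-- A continuous path `X`, playing the role of `w - η`, that solves the equation on `[0, T]` with
forcing `η = ∑ c_z e_z` whose coefficients are bounded by `δ`. -/
structure SmallForcingPath (ν : ℝ) (Z : Finset (Fin 2 → ℤ)) (δ T : ℝ) (X : ℝ → L2)
    (c : (Fin 2 → ℤ) → ℝ → ℝ) : Prop where
  cont : Continuous X
  meas : ∀ z, Measurable (c z)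
  small : ∀ z ∈ Z, ∀ s ∈ Set.Icc 0 T, |c z s| ≤ δ
  mean : ∀ s, inner ℝ (X s) (modeL2 0) = 0
  sobolev : ∫⁻ s in Set.Icc 0 T, sobolevSq (X s) < ∞
  weak : ∀ k ≠ 0, ∀ t ∈ Set.Icc 0 T, inner ℝ (X t) (modeL2 k) = inner ℝ (X 0) (modeL2 k) +
    ∫ s in (0 : ℝ)..t, driftMode ν (X s + ∑ z ∈ Z, c z s • modeL2 z) k

namespace SmallForcingPath

variable {ν : ℝ} {Z : Finset (Fin 2 → ℤ)} {δ T : ℝ} {X : ℝ → L2} {c : (Fin 2 → ℤ) → ℝ → ℝ}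

lemma ae_sobolev_ne_top (h : SmallForcingPath ν Z δ T X c) :
    ∀ᵐ s ∂volume.restrict (Set.Icc 0 T), sobolevSq (X s) ≠ ∞ := by
  filter_upwards [ae_lt_top (measurable_sobolevSq_comp h.cont) h.sobolev.ne] with s hs
  exact hs.ne

lemma integrableOn_sobolev (h : SmallForcingPath ν Z δ T X c) :
    IntegrableOn (fun s => (sobolevSq (X s)).toReal) (Set.Icc 0 T) :=
  integrable_toReal_of_lintegral_ne_top (measurable_sobolevSq_comp h.cont).aemeasurable
    h.sobolev.ne

lemma exists_norm_bound (h : SmallForcingPath ν Z δ T X c) :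
    ∃ B, 0 ≤ B ∧ ∀ s ∈ Set.Icc 0 T, ‖X s‖ ≤ B := by
  obtain ⟨B, hB⟩ := (isCompact_Icc (a := (0 : ℝ)) (b := T)).exists_bound_of_continuousOn
    h.cont.continuousOn
  exact ⟨max B 0, le_max_right _ _, fun s hs => (hB s hs).trans (le_max_left _ _)⟩

lemma integrableOn_driftMode (hν : 0 ≤ ν) (hZ : 0 ∉ Z) (h : SmallForcingPath ν Z δ T X c)
    (k : Fin 2 → ℤ) :
    IntegrableOn (fun s => driftMode ν (X s + ∑ z ∈ Z, c z s • modeL2 z) k) (Set.Icc 0 T) := by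
  obtain ⟨B, hB0, hB⟩ := h.exists_norm_bound
  set N : ℝ := 2 * Real.pi ^ 2 * ∑ z ∈ Z, normSq z with hN
  have hN0 : 0 ≤ N := by
    have : 0 ≤ ∑ z ∈ Z, normSq z := Finset.sum_nonneg fun z _ => normSq_nonneg z
    positivity
  have hη : ∀ s ∈ Set.Icc 0 T, sobolevSq (∑ z ∈ Z, c z s • modeL2 z) ≤
      ENNReal.ofReal (N * δ ^ 2) := fun s hs =>
    sobolevSq_sum_smul_le hZ fun z hz => h.small z hz s hs
  have hηn : ∀ s ∈ Set.Icc 0 T, ‖∑ z ∈ Z, c z s • modeL2 z‖ ≤ ∑ z ∈ Z, δ * ‖modeL2 z‖ := by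
    intro s hs
    refine (norm_sum_le _ _).trans (Finset.sum_le_sum fun z hz => ?_)
    rw [norm_smul]
    exact mul_le_mul_of_nonneg_right (h.small z hz s hs) (norm_nonneg _)
  have hmul : ∀ x : ℝ≥0∞, x ≠ ∞ → 2 * x ≠ ∞ := fun x hx => ENNReal.mul_ne_top (by norm_num) hx
  have hwS : ∀ s ∈ Set.Icc 0 T, sobolevSq (X s) ≠ ∞ →
      sobolevSq (X s + ∑ z ∈ Z, c z s • modeL2 z) ≠ ∞ ∧
      (sobolevSq (X s + ∑ z ∈ Z, c z s • modeL2 z)).toReal ≤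
        2 * (sobolevSq (X s)).toReal + 2 * (N * δ ^ 2) := by
    intro s hs hX
    have hηtop := ne_top_of_le_ne_top ENNReal.ofReal_ne_top (hη s hs)
    have hle := sobolevSq_add_le (X s) (∑ z ∈ Z, c z s • modeL2 z)
    have htop := ENNReal.add_ne_top.2 ⟨hmul _ hX, hmul _ hηtop⟩
    refine ⟨ne_top_of_le_ne_top htop hle, ?_⟩
    have h1 := ENNReal.toReal_mono htop hle
    rw [ENNReal.toReal_add (hmul _ hX) (hmul _ hηtop), ENNReal.toReal_mul,
      ENNReal.toReal_mul] at h1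
    simp only [ENNReal.toReal_ofNat] at h1
    have h2 := ENNReal.toReal_le_of_le_ofReal (by positivity) (hη s hs)
    linarith
  have hmeas : AEMeasurable (fun s => driftMode ν (X s + ∑ z ∈ Z, c z s • modeL2 z) k)
      (volume.restrict (Set.Icc 0 T)) := by
    refine aemeasurable_driftMode (fun g => ?_) ?_ ν k
    · simp only [inner_add_left, sum_inner, real_inner_smul_left]
      refine Measurable.add ?_ (Finset.measurable_fun_sum _ fun z _ => (h.meas z).mul_const _)
      have := h.cont
      exact Continuous.measurable (by fun_prop)
    · filter_upwards [h.ae_sobolev_ne_top, ae_restrict_mem measurableSet_Icc] with s hs hsI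
      exact (hwS s hsI hs).1
  set A : ℝ := ν * normSq k * ‖modeL2 k‖ + 2 * velConst * √(2 * Real.pi ^ 2 * normSq k) with hA
  have hA0 : 0 ≤ A := by
    have := velConst_nonneg
    have := normSq_nonneg k
    positivity
  set B' : ℝ := B + ∑ z ∈ Z, δ * ‖modeL2 z‖ with hB'
  have hdom : IntegrableOn (fun s => A * B' * (1 + (2 * (sobolevSq (X s)).toReal +
      2 * (N * δ ^ 2)))) (Set.Icc 0 T) := by
    refine Integrable.const_mul ?_ _
    exact (integrable_const _).add ((h.integrableOn_sobolev.const_mul 2).add (integrable_const _))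
  refine Integrable.mono' hdom hmeas.aestronglyMeasurable ?_
  filter_upwards [h.ae_sobolev_ne_top, ae_restrict_mem measurableSet_Icc] with s hs hsI
  obtain ⟨h1, h2⟩ := hwS s hsI hs
  have hn : ‖X s + ∑ z ∈ Z, c z s • modeL2 z‖ ≤ B' :=
    (norm_add_le _ _).trans (add_le_add (hB s hsI) (hηn s hsI))
  rw [Real.norm_eq_abs]
  refine (abs_driftMode_le hν h1 k).trans ?_
  have hB'0 : 0 ≤ B' := (norm_nonneg _).trans hn
  have : (0 : ℝ) ≤ (sobolevSq (X s + ∑ z ∈ Z, c z s • modeL2 z)).toReal := ENNReal.toReal_nonneg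
  gcongr

/-- The energy balance of the Galerkin truncations. -/
lemma norm_truncation_sub_eq (hν : 0 ≤ ν) (hZ : 0 ∉ Z) (h : SmallForcingPath ν Z δ T X c)
    (F : Finset (Fin 2 → ℤ)) {s t : ℝ} (hs : 0 ≤ s) (hst : s ≤ t) (ht : t ≤ T) :
    IntervalIntegrable (fun r => 2 * ∑ k ∈ F, inner ℝ (X r) (modeL2 k) / modeNormSq k *
        driftMode ν (X r + ∑ z ∈ Z, c z r • modeL2 z) k) volume s t ∧
    ‖truncation (X t) F‖ ^ 2 - ‖truncation (X s) F‖ ^ 2 =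
      ∫ r in s..t, 2 * ∑ k ∈ F, inner ℝ (X r) (modeL2 k) / modeNormSq k *
        driftMode ν (X r + ∑ z ∈ Z, c z r • modeL2 z) k := by
  have hT : 0 ≤ T := hs.trans (hst.trans ht)
  have hfi : ∀ k, IntegrableOn (fun s => driftMode ν (X s + ∑ z ∈ Z, c z s • modeL2 z) k)
      (Set.Icc 0 T) := h.integrableOn_driftMode hν hZ
  have hX := h.cont
  have hint : ∀ k, IntervalIntegrable (fun r => inner ℝ (X r) (modeL2 k) / modeNormSq k *
        driftMode ν (X r + ∑ z ∈ Z, c z r • modeL2 z) k) volume s t := by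
    intro k
    refine (intervalIntegrable_of_integrableOn (hfi k) hs hst ht).continuousOn_mul ?_
    exact Continuous.continuousOn (by fun_prop)
  have hterm : ∀ k, inner ℝ (X t) (modeL2 k) ^ 2 / modeNormSq k -
      inner ℝ (X s) (modeL2 k) ^ 2 / modeNormSq k =
      2 * ∫ r in s..t, inner ℝ (X r) (modeL2 k) / modeNormSq k *
        driftMode ν (X r + ∑ z ∈ Z, c z r • modeL2 z) k := by
    intro k
    by_cases hk : k = 0
    · simp [hk, h.mean]
    · have h1 := sq_sub_sq_eq_integral (y := fun r => inner ℝ (X r) (modeL2 k))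
        (intervalIntegrable_of_integrableOn (hfi k) le_rfl hT le_rfl) (h.weak k hk) hs hst ht
      have h2 : ∀ r, inner ℝ (X r) (modeL2 k) / modeNormSq k *
          driftMode ν (X r + ∑ z ∈ Z, c z r • modeL2 z) k = (modeNormSq k)⁻¹ *
          (inner ℝ (X r) (modeL2 k) * driftMode ν (X r + ∑ z ∈ Z, c z r • modeL2 z) k) :=
        fun r => by ring
      simp only [h2]
      rw [← sub_div, h1, intervalIntegral.integral_const_mul, intervalIntegral.integral_const_mul]
      ring
  constructor
  · have := (IntervalIntegrable.sum F fun k _ => hint k).const_mul 2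
    simpa only [Finset.sum_apply] using this
  · rw [norm_truncation_sq, norm_truncation_sq, ← Finset.sum_sub_distrib,
      intervalIntegral.integral_const_mul, intervalIntegral.integral_finsetSum fun k _ => hint k,
      Finset.mul_sum]
    exact Finset.sum_congr rfl fun k _ => hterm k

end SmallForcingPath

open SmallForcingPath in
/-- The energy inequality: passing to the limit in the Galerkin balance, the advection error
vanishes by dominated convergence, thanks to `‖𝒦w‖_∞ ≤ c ‖w‖₁`. -/
lemma exists_energy_inequality {ν : ℝ} (hν : 0 < ν) {Z : Finset (Fin 2 → ℤ)} (hZ : 0 ∉ Z) :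
    ∃ K : ℝ, 0 ≤ K ∧ ∀ δ : ℝ, 0 ≤ δ → δ ≤ 1 → K * δ ≤ ν →
      ∀ (T : ℝ) (X : ℝ → L2) (c : (Fin 2 → ℤ) → ℝ → ℝ), SmallForcingPath ν Z δ T X c →
      ∀ s t : ℝ, 0 ≤ s → s ≤ t → t ≤ T →
        ‖X t‖ ^ 2 + ν * (∫ r in s..t, ‖X r‖ ^ 2) ≤ ‖X s‖ ^ 2 + K * δ * (t - s) := by
  obtain ⟨K, hK0, hK⟩ := galerkin_energy_bound hν.le hZ
  refine ⟨K, hK0, ?_⟩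
  intro δ hδ0 hδ1 hKδ T X c h s t hs hst ht
  have hX := h.cont
  obtain ⟨B, hB0, hB⟩ := h.exists_norm_bound
  set D : ℝ → ℝ := fun r => (sobolevSq (X r)).toReal with hD
  have hD0 : ∀ r, 0 ≤ D r := fun r => ENNReal.toReal_nonneg
  have hDi : IntervalIntegrable D volume s t :=
    intervalIntegrable_of_integrableOn h.integrableOn_sobolev hs hst ht
  have hDm : Measurable D := (measurable_sobolevSq_comp hX).ennreal_toReal
  have hI : ∀ r ∈ Set.uIoc s t, r ∈ Set.Icc 0 T := by
    intro r hr
    rw [Set.uIoc_of_le hst] at hr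
    exact ⟨hs.trans hr.1.le, hr.2.trans ht⟩
  have hfin : ∀ᵐ r, r ∈ Set.uIoc s t → sobolevSq (X r) ≠ ∞ := by
    have := (ae_restrict_iff' measurableSet_Icc).1 h.ae_sobolev_ne_top
    filter_upwards [this] with r hr hrI using hr (hI r hrI)
  set DF : Finset (Fin 2 → ℤ) → ℝ → ℝ := fun F r =>
    ∑ k ∈ F, normSq k * inner ℝ (X r) (modeL2 k) ^ 2 / (2 * Real.pi ^ 2) with hDF
  set R : Finset (Fin 2 → ℤ) → ℝ → ℝ := fun F r => ‖X r - truncation (X r) F‖ with hR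
  set b : Finset (Fin 2 → ℤ) → ℝ → ℝ := fun F r =>
    -(2 * ν * DF F r) + K * δ * (1 + D r) + K * R F r * (1 + D r) with hb
  have hRc : ∀ F, Continuous (R F) := by
    intro F
    simp only [hR, truncation]
    fun_prop
  have hDFc : ∀ F, Continuous (DF F) := by
    intro F
    simp only [hDF]
    fun_prop
  have hbm : ∀ F, Measurable (b F) := by
    intro F
    have h1 := (hRc F).measurable
    have h2 := (hDFc F).measurable
    simp only [hb]
    fun_prop
  set dom : ℝ → ℝ := fun r => (2 * ν + K * δ + K * (2 * B)) * (1 + D r) with hdom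
  have hdomi : IntervalIntegrable dom volume s t := (intervalIntegrable_const.add hDi).const_mul _
  have hDF0 : ∀ F r, 0 ≤ DF F r := fun F r => Finset.sum_nonneg fun k _ => sobolev_term_nonneg _ k
  have hbdom : ∀ F, ∀ᵐ r, r ∈ Set.uIoc s t → ‖b F r‖ ≤ dom r := by
    intro F
    filter_upwards [hfin] with r hr hrI
    have hDFle : DF F r ≤ 1 + D r := by
      have : DF F r ≤ D r :=
        sum_le_hasSum F (fun k _ => sobolev_term_nonneg _ k) (hasSum_sobolevSq (hr hrI))
      linarith
    have hRle : R F r ≤ 2 * B :=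
      (norm_sub_truncation_le _ _).trans (by linarith [hB r (hI r hrI)])
    have h1D : 0 ≤ 1 + D r := by linarith [hD0 r]
    have hR0 : 0 ≤ R F r := norm_nonneg _
    have e1 : |2 * ν * DF F r| ≤ 2 * ν * (1 + D r) := by
      rw [abs_of_nonneg (mul_nonneg (by positivity) (hDF0 F r))]
      gcongr
    have e2 : |K * δ * (1 + D r)| = K * δ * (1 + D r) := abs_of_nonneg (by positivity)
    have e3 : |K * R F r * (1 + D r)| ≤ K * (2 * B) * (1 + D r) := by
      rw [abs_of_nonneg (by positivity)]
      gcongr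
    rw [Real.norm_eq_abs]
    calc |b F r| ≤ |2 * ν * DF F r| + |K * δ * (1 + D r)| + |K * R F r * (1 + D r)| := by
          refine (abs_add_le _ _).trans ?_
          gcongr
          refine (abs_add_le _ _).trans ?_
          rw [abs_neg]
      _ ≤ dom r := by
          simp only [hdom]
          linarith
  have hbi : ∀ F, IntervalIntegrable (b F) volume s t := by
    intro F
    refine hdomi.mono_fun (hbm F).aestronglyMeasurable ?_
    refine (ae_restrict_iff' measurableSet_uIoc).2 ?_
    filter_upwards [hbdom F] with r hr hrI using (hr hrI).trans (Real.le_norm_self _)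
  have hlim : ∀ᵐ r, r ∈ Set.uIoc s t → Filter.Tendsto (fun F => b F r) Filter.atTop
      (nhds (-(2 * ν * D r) + K * δ * (1 + D r))) := by
    filter_upwards [hfin] with r hr hrI
    have h1 : Filter.Tendsto (fun F => DF F r) Filter.atTop (nhds (D r)) :=
      hasSum_sobolevSq (hr hrI)
    have h2 : Filter.Tendsto (fun F => R F r) Filter.atTop (nhds 0) := tendsto_truncation _
    have h3 := (((h1.const_mul (2 * ν)).neg).add_const (K * δ * (1 + D r))).add
      ((h2.const_mul K).mul_const (1 + D r))
    simpa using h3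
  have hconv := intervalIntegral.tendsto_integral_filter_of_dominated_convergence dom
    (Filter.Eventually.of_forall fun F => (hbm F).aestronglyMeasurable)
    (Filter.Eventually.of_forall hbdom) hdomi hlim
  have hE : ∀ r, Filter.Tendsto (fun F => ‖truncation (X r) F‖ ^ 2) Filter.atTop
      (nhds (‖X r‖ ^ 2)) := by
    intro r
    have h1 : Filter.Tendsto (truncation (X r)) Filter.atTop (nhds (X r)) := hasSum_modes (X r)
    exact h1.norm.pow 2
  have hle : ‖X t‖ ^ 2 - ‖X s‖ ^ 2 ≤ ∫ r in s..t, (-(2 * ν * D r) + K * δ * (1 + D r)) := by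
    refine le_of_tendsto_of_tendsto' ((hE t).sub (hE s)) hconv fun F => ?_
    obtain ⟨hi, heq⟩ := h.norm_truncation_sub_eq hν.le hZ F hs hst ht
    rw [heq]
    refine intervalIntegral.integral_mono_ae_restrict hst hi (hbi F) ?_
    rw [Filter.EventuallyLE, ae_restrict_iff' measurableSet_Icc]
    have hfin' := (ae_restrict_iff' measurableSet_Icc).1 h.ae_sobolev_ne_top
    filter_upwards [hfin'] with r hr hrI
    have hrT : r ∈ Set.Icc 0 T := ⟨hs.trans hrI.1, hrI.2.trans ht⟩
    exact hK (X r) (hr hrT) (h.mean r) δ hδ0 hδ1 (fun z => c z r)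
      (fun z hz => h.small z hz r hrT) F
  -- half of the dissipation absorbs the forcing, Poincaré's inequality bounds the other half
  have hle2 : ∫ r in s..t, (-(2 * ν * D r) + K * δ * (1 + D r)) ≤
      ∫ r in s..t, (-(ν * ‖X r‖ ^ 2) + K * δ) := by
    have hXi : IntervalIntegrable (fun r => -(ν * ‖X r‖ ^ 2) + K * δ) volume s t :=
      Continuous.intervalIntegrable (by fun_prop) _ _
    refine intervalIntegral.integral_mono_ae_restrict hst
      (((hDi.const_mul (2 * ν)).neg).add ((intervalIntegrable_const.add hDi).const_mul (K * δ)))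
      hXi ?_
    rw [Filter.EventuallyLE, ae_restrict_iff' measurableSet_Icc]
    have hfin' := (ae_restrict_iff' measurableSet_Icc).1 h.ae_sobolev_ne_top
    filter_upwards [hfin'] with r hr hrI
    have hrT : r ∈ Set.Icc 0 T := ⟨hs.trans hrI.1, hrI.2.trans ht⟩
    have hp := norm_sq_le_sobolevSq (hr hrT) (h.mean r)
    change ‖X r‖ ^ 2 ≤ D r at hp
    have h1 := mul_le_mul_of_nonneg_right hKδ (hD0 r)
    have h2 := mul_le_mul_of_nonneg_left hp hν.le
    change -(2 * ν * D r) + K * δ * (1 + D r) ≤ _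
    linarith
  have heq : ∫ r in s..t, (-(ν * ‖X r‖ ^ 2) + K * δ) =
      -(ν * ∫ r in s..t, ‖X r‖ ^ 2) + K * δ * (t - s) := by
    have hXc : IntervalIntegrable (fun r => -(ν * ‖X r‖ ^ 2)) volume s t :=
      Continuous.intervalIntegrable (by fun_prop) _ _
    rw [intervalIntegral.integral_add hXc intervalIntegrable_const,
      intervalIntegral.integral_neg, intervalIntegral.integral_const_mul,
      intervalIntegral.integral_const, smul_eq_mul]
    ring
  linarith

/-- Decay: a function with `φ(t) + ν ∫ φ ≤ φ(s) + κ (t - s)` and `φ(0) ≤ A` is small at a time `T`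
that is large compared with `A`, if `κ` is small. Otherwise the dissipation up to time `T` would
exceed `A`. -/
lemma le_of_energy_inequality {φ : ℝ → ℝ} (hφ : Continuous φ) {ν κ A ε T : ℝ} (hν : 0 < ν)
    (hT : 0 < T) (hκ : 0 ≤ κ) (hκε : 2 * κ ≤ ν * ε) (hφ0 : ∀ t, 0 ≤ φ t) (h0 : φ 0 ≤ A)
    (hA : 2 * A < ν * ε * T)
    (h : ∀ s t : ℝ, 0 ≤ s → s ≤ t → t ≤ T →
      φ t + ν * (∫ r in s..t, φ r) ≤ φ s + κ * (t - s)) :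
    φ T ≤ ε + κ * T := by
  by_cases hex : ∃ s ∈ Set.Icc 0 T, φ s ≤ ε
  · obtain ⟨s, hs, hsε⟩ := hex
    have h1 := h s T hs.1 hs.2 le_rfl
    have h2 : 0 ≤ ∫ r in s..T, φ r := intervalIntegral.integral_nonneg hs.2 fun r _ => hφ0 r
    have h3 : 0 ≤ ν * ∫ r in s..T, φ r := by positivity
    have h4 := mul_nonneg hκ hs.1
    linarith
  · exfalso
    push Not at hex
    have h1 := h 0 T le_rfl hT.le le_rfl
    have h2 : ∫ _ in (0 : ℝ)..T, ε ≤ ∫ r in (0 : ℝ)..T, φ r :=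
      intervalIntegral.integral_mono_on hT.le intervalIntegrable_const
        (hφ.intervalIntegrable _ _) fun r hr => (hex r hr).le
    rw [intervalIntegral.integral_const, smul_eq_mul, sub_zero] at h2
    have h3 := mul_le_mul_of_nonneg_left h2 hν.le
    have h4 := mul_le_mul_of_nonneg_right hκε hT.le
    have h5 := hφ0 T
    nlinarith

/-! ### Solutions with small forcing are small at a large time -/

/-- A solution with small forcing, written for `w - η`. The weak formulation at time `0` gives
`w(0) - η(0) = w₀`. -/
lemma isSolutionPath_smallForcing {ν : ℝ} {Z : Finset (Fin 2 → ℤ)} (hZ : 0 ∉ Z) {δ : ℝ}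
    {T : ℝ≥0} {c : Z → ℝ≥0 → ℝ} (hcm : ∀ z, Measurable (c z))
    (hc : ∀ z, ∀ t ≤ T, |c z t| ≤ δ) {w₀ : H} {w : ℝ≥0 → H}
    (hw : IsSolutionPath ν (fun t => ∑ z : Z, c z t • modeL2 z) w₀ w) :
    SmallForcingPath ν Z δ T
        (fun s => (w s.toNNReal : L2) - ∑ z : Z, c z s.toNNReal • modeL2 z)
        (fun z s => if h : z ∈ Z then c ⟨z, h⟩ s.toNNReal else 0) ∧
      ‖(w 0 : L2) - ∑ z : Z, c z 0 • modeL2 z‖ = ‖w₀‖ := by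
  have hsum : ∀ s : ℝ, ∑ z ∈ Z, (if h : z ∈ Z then c ⟨z, h⟩ s.toNNReal else 0) • modeL2 z =
      ∑ z : Z, c z s.toNNReal • modeL2 z := by
    intro s
    rw [← Finset.sum_coe_sort Z]
    exact Finset.sum_congr rfl fun z _ => by simp
  have hmean : ∀ s : ℝ, inner ℝ ((w s.toNNReal : L2) - ∑ z : Z, c z s.toNNReal • modeL2 z)
      (modeL2 0) = 0 := by
    intro s
    rw [inner_sub_left, (mem_H_iff _).1 (w s.toNNReal).2, ← hsum, inner_sum_smul_modeL2 hZ,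
      if_neg hZ, sub_zero]
  have hinit : ∀ k, k ≠ 0 → inner ℝ ((w 0 : L2) - ∑ z : Z, c z 0 • modeL2 z) (modeL2 k) =
      inner ℝ (w₀ : L2) (modeL2 k) := by
    intro k hk
    simpa using hw.weak k hk 0
  refine ⟨⟨?_, ?_, ?_, hmean, hw.sobolev T, ?_⟩, ?_⟩
  · exact hw.continuous_sub.comp continuous_real_toNNReal
  · intro z
    by_cases h : z ∈ Z
    · simp only [h, dif_pos]
      exact (hcm ⟨z, h⟩).comp measurable_real_toNNReal
    · simp only [h, dif_neg, not_false_iff]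
      exact measurable_const
  · intro z hz s hs
    rw [dif_pos hz]
    exact hc _ _ (Real.toNNReal_le_iff_le_coe.2 hs.2)
  · intro k hk t ht
    have h := hw.weak k hk t.toNNReal
    rw [Real.coe_toNNReal t ht.1] at h
    simp only [hsum, Real.toNNReal_zero, sub_add_cancel]
    rw [hinit k hk, h]
    rfl
  · have h1 := hasSum_inner_sq ((w 0 : L2) - ∑ z : Z, c z 0 • modeL2 z)
    have h2 := hasSum_inner_sq (w₀ : L2)
    have h3 := hmean 0
    rw [Real.toNNReal_zero] at h3
    have heq : (fun k => inner ℝ ((w 0 : L2) - ∑ z : Z, c z 0 • modeL2 z) (modeL2 k) ^ 2 /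
        modeNormSq k) = fun k => inner ℝ (w₀ : L2) (modeL2 k) ^ 2 / modeNormSq k := by
      funext k
      by_cases hk : k = 0
      · rw [hk, h3, (mem_H_iff _).1 w₀.2]
      · rw [hinit k hk]
    rw [heq] at h1
    exact (sq_eq_sq₀ (norm_nonneg _) (norm_nonneg _)).1 (h1.unique h2)

/-- If the forcing stays small on `[0, T]`, then the solution decays into a given ball by time `T`:
this is approximate controllability to zero with negligible control. -/
lemma exists_time_forcing_bound {ν : ℝ} (hν : 0 < ν) {Z : Finset (Fin 2 → ℤ)} (hZ : 0 ∉ Z)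
    (C : ℝ) {γ : ℝ} (hγ : 0 < γ) :
    ∃ T : ℝ≥0, 0 < T ∧ ∃ δ : ℝ, 0 < δ ∧ ∀ c : Z → ℝ≥0 → ℝ, (∀ z, Measurable (c z)) →
      (∀ z, ∀ t ≤ T, |c z t| ≤ δ) → ∀ w₀ : H, ‖w₀‖ ≤ C → ∀ w : ℝ≥0 → H,
      IsSolutionPath ν (fun t => ∑ z : Z, c z t • modeL2 z) w₀ w → ‖w T‖ ≤ γ := by
  obtain ⟨K, hK0, hK⟩ := exists_energy_inequality hν hZ
  set ε : ℝ := γ ^ 2 / 8 with hε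
  have hε0 : 0 < ε := by positivity
  set T : ℝ := (2 * C ^ 2 + 1) / (ν * ε) with hT
  have hT0 : 0 < T := by positivity
  set E : ℝ := ∑ z : Z, ‖modeL2 z‖ with hE
  have hE0 : 0 ≤ E := Finset.sum_nonneg fun z _ => norm_nonneg _
  set δ : ℝ := min (min 1 (ν / (K + 1))) (min (min (ν * ε / (2 * (K + 1))) (ε / ((K + 1) * T)))
    (γ / (2 * (E + 1)))) with hδ
  have hδ0 : 0 < δ := by
    simp only [hδ, lt_min_iff]
    refine ⟨⟨?_, ?_⟩, ⟨?_, ?_⟩, ?_⟩ <;> positivity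
  have hδ1 : δ ≤ 1 := (min_le_left _ _).trans (min_le_left _ _)
  have hδ2 : δ ≤ ν / (K + 1) := (min_le_left _ _).trans (min_le_right _ _)
  have hδ3 : δ ≤ ν * ε / (2 * (K + 1)) :=
    (min_le_right _ _).trans ((min_le_left _ _).trans (min_le_left _ _))
  have hδ4 : δ ≤ ε / ((K + 1) * T) :=
    (min_le_right _ _).trans ((min_le_left _ _).trans (min_le_right _ _))
  have hδ5 : δ ≤ γ / (2 * (E + 1)) := (min_le_right _ _).trans (min_le_right _ _)
  rw [le_div_iff₀ (by positivity)] at hδ2 hδ3 hδ4 hδ5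
  clear_value δ
  have hKν : K * δ ≤ ν := by linarith
  have hKε : 2 * (K * δ) ≤ ν * ε := by linarith
  have hKT : K * δ * T ≤ ε := by linarith [mul_pos hδ0 hT0]
  have hδE : δ * E ≤ γ / 2 := by linarith
  have hTA : 2 * C ^ 2 < ν * ε * T := by
    rw [hT]
    field_simp
    linarith
  clear_value T ε
  refine ⟨⟨T, hT0.le⟩, hT0, δ, hδ0, ?_⟩
  intro c hcm hc w₀ hw₀ w hw
  obtain ⟨hpath, hnorm⟩ := isSolutionPath_smallForcing hZ hcm hc hw
  have hen := hK δ hδ0.le hδ1 hKν T _ _ hpath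
  have hX := hpath.cont
  set X : ℝ → L2 := fun s => (w s.toNNReal : L2) - ∑ z : Z, c z s.toNNReal • modeL2 z with hXdef
  have hX0 : ‖X 0‖ ^ 2 ≤ C ^ 2 := by
    have : ‖X 0‖ = ‖w₀‖ := by
      rw [← hnorm]
      simp only [hXdef, Real.toNNReal_zero]
    rw [this]
    gcongr
  have hφ := le_of_energy_inequality (φ := fun t => ‖X t‖ ^ 2) (κ := K * δ) (A := C ^ 2) (ε := ε)
    (by fun_prop) hν hT0 (by positivity) hKε (fun t => sq_nonneg _) hX0
    hTA hen
  have hXT : ‖X T‖ ≤ γ / 2 := by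
    refine abs_le_of_sq_le_sq' ?_ (by positivity) |>.2
    refine hφ.trans ?_
    rw [hε] at hKT ⊢
    linarith
  have hTt : T.toNNReal = ⟨T, hT0.le⟩ := Real.toNNReal_of_nonneg hT0.le
  have hη : ‖∑ z : Z, c z ⟨T, hT0.le⟩ • modeL2 z‖ ≤ γ / 2 := by
    calc ‖∑ z : Z, c z ⟨T, hT0.le⟩ • modeL2 z‖
        ≤ ∑ z : Z, ‖c z ⟨T, hT0.le⟩ • modeL2 z‖ := norm_sum_le _ _
      _ ≤ ∑ z : Z, δ * ‖modeL2 z‖ := by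
          refine Finset.sum_le_sum fun z _ => ?_
          rw [norm_smul]
          exact mul_le_mul_of_nonneg_right (hc z _ le_rfl) (norm_nonneg _)
      _ = δ * E := by rw [← Finset.mul_sum]
      _ ≤ γ / 2 := hδE
  have hdec : (w ⟨T, hT0.le⟩ : L2) = X T + ∑ z : Z, c z ⟨T, hT0.le⟩ • modeL2 z := by
    simp only [hXdef, hTt, sub_add_cancel]
  change ‖(w ⟨T, hT0.le⟩ : L2)‖ ≤ γ
  rw [hdec]
  linarith [norm_add_le (X T) (∑ z : Z, c z ⟨T, hT0.le⟩ • modeL2 z)]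

/-! ### The subordinator stays small with positive probability -/

/-- The Laplace exponent `Φ(r) = ∫ (1 - exp (-r u)) νS(du)` has no linear part: `Φ(r) / r → 0`. -/
lemma tendsto_laplaceExponent_div {νS : Measure ℝ} (hνS : AdmissibleLevyMeasure νS) :
    Filter.Tendsto (fun r : ℝ => ∫ u, (1 - Real.exp (-(r * u))) / r ∂νS) Filter.atTop (nhds 0) := by
  have hpos : ∀ᵐ u ∂νS, 0 < u := by
    have h : {u : ℝ | ¬ 0 < u} = Set.Iic 0 := by
      ext u
      simp
    rw [ae_iff, h]
    exact hνS.support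
  have hint : Integrable (fun u : ℝ => min 1 u) νS := by
    refine ⟨by fun_prop, ?_⟩
    rw [hasFiniteIntegral_iff_ofReal]
    · exact hνS.integrable
    · filter_upwards [hpos] with u hu
      exact le_min zero_le_one hu.le
  have h0 : ∫ _ : ℝ, (0 : ℝ) ∂νS = 0 := by simp
  rw [← h0]
  refine tendsto_integral_filter_of_dominated_convergence (fun u => min 1 u) ?_ ?_ hint ?_
  · exact Filter.Eventually.of_forall fun r => by fun_prop
  · filter_upwards [Filter.eventually_ge_atTop 1] with r hr
    filter_upwards [hpos] with u hu
    have hr0 : 0 < r := by linarith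
    have he1 : Real.exp (-(r * u)) ≤ 1 := Real.exp_le_one_iff.2 (by nlinarith)
    have he2 : 1 - r * u ≤ Real.exp (-(r * u)) := by linarith [Real.add_one_le_exp (-(r * u))]
    rw [Real.norm_eq_abs, abs_of_nonneg (div_nonneg (by linarith) hr0.le)]
    refine le_min ?_ ?_
    · rw [div_le_one hr0]
      linarith [Real.exp_pos (-(r * u))]
    · rw [div_le_iff₀ hr0]
      linarith
  · filter_upwards [hpos] with u hu
    refine squeeze_zero' (g := fun r : ℝ => r⁻¹) ?_ ?_ tendsto_inv_atTop_zero
    · filter_upwards [Filter.eventually_gt_atTop 0] with r hr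
      have he1 : Real.exp (-(r * u)) ≤ 1 := Real.exp_le_one_iff.2 (by nlinarith [mul_pos hr hu])
      exact div_nonneg (by linarith) hr.le
    · filter_upwards [Filter.eventually_gt_atTop 0] with r hr
      rw [div_eq_mul_inv]
      exact mul_le_of_le_one_left (by positivity) (by linarith [Real.exp_pos (-(r * u))])

/-- For a driftless subordinator the Laplace exponent is sublinear, hence
`P(S_T ≤ ε) ≥ E exp (-r S_T) - exp (-r ε) > 0` for large `r`. -/
lemma exists_le_prob_subordinator_le {νS : Measure ℝ} (hνS : AdmissibleLevyMeasure νS) (T : ℝ≥0)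
    {ε : ℝ≥0} (hε : 0 < ε) :
    ∃ p : ℝ, 0 < p ∧ ∀ (Ω : Type*) [MeasurableSpace Ω] (P : Measure Ω) [IsProbabilityMeasure P]
      (S : ℝ≥0 → Ω → ℝ≥0), IsPureJumpSubordinator P νS S → p ≤ P.real {ω | S T ω ≤ ε} := by
  have hlim := (tendsto_laplaceExponent_div hνS).const_mul (T : ℝ)
  rw [mul_zero] at hlim
  have hε' : (0 : ℝ) < ε := by exact_mod_cast hε
  obtain ⟨r, hr1, hr0⟩ := ((hlim.eventually (gt_mem_nhds hε')).and
    (Filter.eventually_gt_atTop 0)).exists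
  rw [integral_div] at hr1
  set Φ : ℝ := ∫ u, (1 - Real.exp (-(r * u))) ∂νS with hΦ
  have hlt : (T : ℝ) * Φ < r * ε := by
    have h := mul_lt_mul_of_pos_left hr1 hr0
    have e : r * ((T : ℝ) * (Φ / r)) = T * Φ := by field_simp
    rwa [e] at h
  refine ⟨Real.exp (-(T * Φ)) - Real.exp (-(r * ε)), sub_pos.2 (Real.exp_lt_exp.2 (by linarith)),
    ?_⟩
  intro Ω _ P _ S hS
  have hmeas : MeasurableSet {ω | S T ω ≤ ε} := measurableSet_le (hS.measurable T) measurable_const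
  have hlap := hS.laplace 0 T zero_le r hr0.le
  have hleft : ∫ ω, Real.exp (-(r * ((S T ω : ℝ) - S 0 ω))) ∂P =
      ∫ ω, Real.exp (-(r * (S T ω : ℝ))) ∂P := by
    refine integral_congr_ae ?_
    filter_upwards [hS.zero] with ω hω
    rw [hω]
    simp
  rw [hleft, NNReal.coe_zero, sub_zero, ← hΦ] at hlap
  have hSm := hS.measurable T
  have hI1 : Integrable (fun ω => Real.exp (-(r * (S T ω : ℝ)))) P := by
    refine Integrable.of_bound (C := 1) (by fun_prop) ?_
    filter_upwards with ω
    rw [Real.norm_eq_abs, abs_of_pos (Real.exp_pos _)]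
    exact Real.exp_le_one_iff.2 (by have := (S T ω).2; nlinarith [mul_nonneg hr0.le this])
  have hind : Integrable ({ω | S T ω ≤ ε}.indicator (fun _ => (1 : ℝ))) P :=
    (integrable_const (1 : ℝ)).indicator hmeas
  have hle : ∫ ω, Real.exp (-(r * (S T ω : ℝ))) ∂P ≤
      ∫ ω, ({ω | S T ω ≤ ε}.indicator (fun _ => (1 : ℝ)) ω + Real.exp (-(r * ε))) ∂P := by
    refine integral_mono hI1 (hind.add (integrable_const _)) fun ω => ?_
    change _ ≤ {ω | S T ω ≤ ε}.indicator (fun _ => (1 : ℝ)) ω + Real.exp (-(r * ε))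
    by_cases hω : S T ω ≤ ε
    · rw [Set.indicator_of_mem (by exact hω)]
      have : Real.exp (-(r * (S T ω : ℝ))) ≤ 1 :=
        Real.exp_le_one_iff.2 (by have := (S T ω).2; nlinarith [mul_nonneg hr0.le this])
      linarith [Real.exp_pos (-(r * (ε : ℝ)))]
    · rw [Set.indicator_of_notMem (by exact hω), zero_add]
      have h : (ε : ℝ) ≤ S T ω := by exact_mod_cast (not_le.1 hω).le
      exact Real.exp_le_exp.2 (neg_le_neg (mul_le_mul_of_nonneg_left h hr0.le))
  rw [integral_add hind (integrable_const _), integral_indicator_const _ hmeas, integral_const,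
    hlap] at hle
  simp at hle
  linarith

/-! ### Brownian motion stays small on a short interval -/

/-- A Gaussian tail bound with decay `x⁻⁴`, enough to sum over the `2ⁿ` dyadic increments of variance
proportional to `2⁻ⁿ`. -/
lemma prob_gaussian_abs_ge_le {Ω : Type*} [MeasurableSpace Ω] {P : Measure Ω}
    [IsProbabilityMeasure P] {Y : Ω → ℝ} {v : ℝ≥0} (hv : 0 < v) (hY : HasLaw Y (gaussianReal 0 v) P)
    {x : ℝ} (hx : 0 < x) : P {ω | x ≤ |Y ω|} ≤ ENNReal.ofReal (16 * v ^ 2 / x ^ 4) := by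
  have key : ∀ Y : Ω → ℝ, HasLaw Y (gaussianReal 0 v) P →
      P.real {ω | x ≤ Y ω} ≤ 8 * v ^ 2 / x ^ 4 := by
    intro Y hY
    have hsub : HasSubgaussianMGF Y v P := by
      constructor
      · intro t
        have h := integrable_exp_mul_gaussianReal (μ := 0) (v := v) t
        rw [← hY.map_eq] at h
        exact (integrable_map_measure (by fun_prop) hY.aemeasurable).1 h
      · intro t
        rw [mgf_gaussianReal hY.map_eq]
        simp
    refine (hsub.measure_ge_le hx.le).trans ?_
    -- `exp (-y) ≤ 2 / y²` at `y = x² / (2 v)`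
    have hv' : (0 : ℝ) < v := by exact_mod_cast hv
    have hy : 0 < x ^ 2 / (2 * v) := by positivity
    have hexp := Real.quadratic_le_exp_of_nonneg hy.le
    have e : -x ^ 2 / (2 * (v : ℝ)) = -(x ^ 2 / (2 * v)) := by ring
    rw [e, Real.exp_neg, inv_le_comm₀ (Real.exp_pos _) (by positivity)]
    refine le_trans (le_of_eq ?_)
      (le_trans (show (x ^ 2 / (2 * (v : ℝ))) ^ 2 / 2 ≤ _ by linarith) hexp)
    field_simp
    norm_num
  have hneg : HasLaw (fun ω => -Y ω) (gaussianReal 0 v) P := by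
    have h := gaussianReal_neg hY
    rw [neg_zero] at h
    exact h
  have hset : {ω | x ≤ |Y ω|} ⊆ {ω | x ≤ Y ω} ∪ {ω | x ≤ -Y ω} := by
    intro ω hω
    simp only [Set.mem_union, Set.mem_ofPred_eq] at hω ⊢
    exact le_abs.1 hω
  refine (measure_mono hset).trans ((measure_union_le _ _).trans ?_)
  rw [← ofReal_measureReal (μ := P), ← ofReal_measureReal (μ := P),
    ← ENNReal.ofReal_add measureReal_nonneg measureReal_nonneg]
  refine ENNReal.ofReal_le_ofReal ?_
  refine (add_le_add (key _ hY) (key _ hneg)).trans (le_of_eq ?_)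
  ring

/-- Chaining: control of the increments between neighbouring dyadic points of each level controls
the function at all dyadic points. -/
lemma abs_dyadic_le {f : ℝ≥0 → ℝ} {ε : ℝ≥0} {a : ℕ → ℝ} (h0 : f 0 = 0) (ha : ∀ n, 0 ≤ a n)
    (h : ∀ n i : ℕ, i < 2 ^ n → |f (ε * ((i + 1 : ℕ) / 2 ^ n)) - f (ε * (i / 2 ^ n))| ≤ a n)
    (n i : ℕ) (hi : i ≤ 2 ^ n) : |f (ε * (i / 2 ^ n))| ≤ ∑ m ∈ Finset.range (n + 1), a m := by
  induction n generalizing i with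
  | zero =>
    have h1 := h 0 0 (by norm_num)
    have hi' : i = 0 ∨ i = 1 := by
      simp at hi
      omega
    rcases hi' with rfl | rfl
    · simpa [h0] using ha 0
    · simpa [h0] using h1
  | succ n ih =>
    have heven : ∀ j : ℕ, j ≤ 2 ^ n → |f (ε * ((2 * j : ℕ) / 2 ^ (n + 1)))| ≤
        ∑ m ∈ Finset.range (n + 1), a m := by
      intro j hj
      have e : ((2 * j : ℕ) : ℝ≥0) / 2 ^ (n + 1) = j / 2 ^ n := by
        rw [pow_succ]
        push_cast
        field_simp
      rw [e]
      exact ih j hj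
    rw [Finset.sum_range_succ]
    rcases Nat.even_or_odd' i with ⟨j, rfl | rfl⟩
    · have := heven j (by rw [pow_succ] at hi; omega)
      linarith [ha (n + 1)]
    · have hj : j ≤ 2 ^ n := by rw [pow_succ] at hi; omega
      have h1 := heven j hj
      have h2 := h (n + 1) (2 * j) (by omega)
      have h3 := abs_sub_abs_le_abs_sub (f (ε * ((2 * j + 1 : ℕ) / 2 ^ (n + 1))))
        (f (ε * ((2 * j : ℕ) / 2 ^ (n + 1))))
      linarith

/-- A bound at the dyadic multiples of `ε` extends to `[0, ε]` by continuity. -/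
lemma abs_le_of_dyadic {f : ℝ≥0 → ℝ} (hf : Continuous f) {ε : ℝ≥0} (hε : 0 < ε) {δ : ℝ}
    (h : ∀ n i : ℕ, i ≤ 2 ^ n → |f (ε * (i / 2 ^ n))| ≤ δ) {t : ℝ≥0} (ht : t ≤ ε) :
    |f t| ≤ δ := by
  have hpow : Filter.Tendsto (fun n : ℕ => (2 : ℝ) ^ n) Filter.atTop Filter.atTop :=
    tendsto_pow_atTop_atTop_of_one_lt (by norm_num)
  have h1 := (tendsto_nat_floor_mul_div_atTop (R := ℝ) (a := t / ε) (by positivity)).comp hpow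
  have h1' : Filter.Tendsto (fun n : ℕ => ((⌊(t / ε : ℝ) * 2 ^ n⌋₊ : ℝ≥0) / 2 ^ n))
      Filter.atTop (nhds (t / ε)) := by
    rw [← NNReal.tendsto_coe]
    push_cast
    exact h1
  have h2 := (hf.tendsto _).comp (h1'.const_mul ε)
  rw [mul_div_cancel₀ _ hε.ne'] at h2
  refine le_of_tendsto h2.abs (Filter.Eventually.of_forall fun n => ?_)
  refine h n _ ?_
  refine Nat.floor_le_of_le ?_
  have h3 : (t / ε : ℝ) ≤ 1 := div_le_one_of_le₀ (by exact_mod_cast ht) ε.2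
  push_cast
  exact mul_le_of_le_one_left (by positivity) h3

/-- Quantitative smallness of Brownian motion on a short interval, uniformly over all its
realisations. -/
lemma exists_prob_brownian_small {δ θ : ℝ} (hδ : 0 < δ) (hθ : 0 < θ) :
    ∃ ε : ℝ≥0, 0 < ε ∧ ∀ (Ω : Type*) [MeasurableSpace Ω] (P : Measure Ω) [IsProbabilityMeasure P]
      (B : ℝ≥0 → Ω → ℝ), IsPreBrownianReal B P →
      P {ω | ∀ n i : ℕ, i ≤ 2 ^ n → |B (ε * (i / 2 ^ n)) ω| ≤ δ}ᶜ ≤ ENNReal.ofReal θ := by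
  -- level `n` is granted the increment `δ (9/10)ⁿ / 10`; as `2 (9/10)⁴ ≥ 5/4`, the exceptional
  -- probabilities of the levels sum geometrically
  set M : ℝ := 800000 / δ ^ 4 with hM
  have hM0 : 0 < M := by positivity
  set e : ℝ := min 1 (θ / M) with he
  have he0 : 0 < e := lt_min one_pos (by positivity)
  have heM : M * e ^ 2 ≤ θ := by
    have h1 : e ≤ 1 := min_le_left _ _
    have h2 : e ≤ θ / M := min_le_right _ _
    rw [le_div_iff₀ hM0] at h2
    have h3 : e ^ 2 ≤ e := by nlinarith
    nlinarith
  refine ⟨⟨e, he0.le⟩, he0, ?_⟩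
  intro Ω _ P _ B hB
  set ε : ℝ≥0 := ⟨e, he0.le⟩ with hε
  set a : ℕ → ℝ := fun n => δ / 10 * (9 / 10) ^ n with ha
  have ha0 : ∀ n, 0 < a n := fun n => by positivity
  have hasum : ∀ n, ∑ m ∈ Finset.range n, a m ≤ δ := by
    intro n
    rw [← Finset.mul_sum]
    have h := (summable_geometric_of_lt_one (r := (9 / 10 : ℝ)) (by norm_num)
      (by norm_num)).sum_le_tsum (Finset.range n) (fun i _ => by positivity)
    rw [tsum_geometric_of_lt_one (by norm_num) (by norm_num)] at h
    calc δ / 10 * ∑ m ∈ Finset.range n, (9 / 10 : ℝ) ^ m ≤ δ / 10 * (1 - 9 / 10)⁻¹ := by gcongr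
      _ = δ := by ring
  set bad : ℕ → ℕ → Set Ω := fun n i =>
    {ω | a n ≤ |B (ε * ((i + 1 : ℕ) / 2 ^ n)) ω - B (ε * (i / 2 ^ n)) ω|} with hbad
  have hbadP : ∀ n i, P (bad n i) ≤ ENNReal.ofReal (16 * (e / 2 ^ n) ^ 2 / a n ^ 4) := by
    intro n i
    have hlaw := hB.hasLaw_sub (ε * ((i + 1 : ℕ) / 2 ^ n)) (ε * (i / 2 ^ n))
    have hd : nndist (ε * ((i + 1 : ℕ) / 2 ^ n) : ℝ≥0).1 (ε * (i / 2 ^ n) : ℝ≥0).1 =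
        ε / 2 ^ n := by
      apply NNReal.coe_injective
      rw [coe_nndist, Real.dist_eq]
      have : ((ε * ((i + 1 : ℕ) / 2 ^ n) : ℝ≥0) : ℝ) - ((ε * (i / 2 ^ n) : ℝ≥0) : ℝ) =
          ((ε / 2 ^ n : ℝ≥0) : ℝ) := by
        push_cast
        ring
      change |((ε * ((i + 1 : ℕ) / 2 ^ n) : ℝ≥0) : ℝ) - ((ε * (i / 2 ^ n) : ℝ≥0) : ℝ)| = _
      rw [this, abs_of_nonneg (NNReal.coe_nonneg _)]
    rw [hd] at hlaw
    have hv : 0 < ε / 2 ^ n := div_pos he0 (by positivity)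
    have h := prob_gaussian_abs_ge_le hv hlaw (ha0 n)
    have e1 : ((ε / 2 ^ n : ℝ≥0) : ℝ) = e / 2 ^ n := by push_cast; rfl
    rw [e1] at h
    exact h
  have hlevel : ∀ n, P (⋃ i ∈ Finset.range (2 ^ n), bad n i) ≤
      ENNReal.ofReal (160000 / δ ^ 4 * e ^ 2 * (4 / 5) ^ n) := by
    intro n
    refine (measure_biUnion_finset_le _ _).trans ((Finset.sum_le_sum fun i _ => hbadP n i).trans ?_)
    rw [Finset.sum_const, Finset.card_range, ← ENNReal.ofReal_nsmul]
    refine ENNReal.ofReal_le_ofReal ?_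
    have h1 : (1 / (2 * (9 / 10) ^ 4) : ℝ) ^ n ≤ (4 / 5) ^ n :=
      pow_le_pow_left₀ (by positivity) (by norm_num) n
    have h2 : (2 ^ n) • (16 * (e / 2 ^ n) ^ 2 / a n ^ 4) =
        160000 / δ ^ 4 * e ^ 2 * (1 / (2 * (9 / 10) ^ 4) : ℝ) ^ n := by
      simp only [ha, nsmul_eq_mul, div_pow, mul_pow, one_pow]
      push_cast
      rw [← pow_mul, ← pow_mul, ← pow_mul, ← pow_mul, mul_comm n 4, pow_mul, pow_mul]
      field_simp
      norm_num
      rw [pow_mul]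
      norm_num
    rw [h2]
    gcongr
  have hsub : {ω | ∀ n i : ℕ, i ≤ 2 ^ n → |B (ε * (i / 2 ^ n)) ω| ≤ δ}ᶜ ⊆
      {ω | B 0 ω ≠ 0} ∪ ⋃ n, ⋃ i ∈ Finset.range (2 ^ n), bad n i := by
    intro ω hω
    by_contra hcon
    simp only [Set.mem_union, Set.mem_iUnion, not_or, not_exists, hbad, Set.mem_ofPred_eq,
      Finset.mem_range, not_le, not_not] at hcon
    refine hω fun n i hi => ?_
    refine (abs_dyadic_le (f := fun t => B t ω) hcon.1 (fun n => (ha0 n).le)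
      (fun n i hi => (hcon.2 n i hi).le) n i hi).trans (hasum _)
  have hzero : P {ω | B 0 ω ≠ 0} = 0 := hB.eval_zero_ae_eq_zero
  have hgeo : HasSum (fun n : ℕ => 160000 / δ ^ 4 * e ^ 2 * (4 / 5 : ℝ) ^ n) (M * e ^ 2) := by
    have h := (hasSum_geometric_of_lt_one (r := (4 / 5 : ℝ)) (by norm_num) (by norm_num)).mul_left
      (160000 / δ ^ 4 * e ^ 2)
    have hval : 160000 / δ ^ 4 * e ^ 2 * (1 - 4 / 5 : ℝ)⁻¹ = M * e ^ 2 := by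
      rw [hM]
      ring
    rwa [hval] at h
  calc P {ω | ∀ n i : ℕ, i ≤ 2 ^ n → |B (ε * (i / 2 ^ n)) ω| ≤ δ}ᶜ
      ≤ P {ω | B 0 ω ≠ 0} + P (⋃ n, ⋃ i ∈ Finset.range (2 ^ n), bad n i) :=
        (measure_mono hsub).trans (measure_union_le _ _)
    _ ≤ 0 + ∑' n : ℕ, ENNReal.ofReal (160000 / δ ^ 4 * e ^ 2 * (4 / 5) ^ n) := by
        rw [hzero]
        gcongr
        exact (measure_iUnion_le _).trans (ENNReal.tsum_le_tsum hlevel)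
    _ = ENNReal.ofReal (M * e ^ 2) := by
        rw [zero_add, ← ENNReal.ofReal_tsum_of_nonneg (fun n => by positivity) hgeo.summable,
          hgeo.tsum_eq]
    _ ≤ ENNReal.ofReal θ := ENNReal.ofReal_le_ofReal heM

/-! ### Small forcing with positive probability -/

/-- The forcing is uniformly small on `[0, T]` with a probability bounded below: the subordinator
stays below `ε` up to time `T`, and the independent Brownian motions stay small up to time `ε`. -/
lemma exists_le_prob_forcing_small {νS : Measure ℝ} (hνS : AdmissibleLevyMeasure νS)
    {Z : Finset (Fin 2 → ℤ)} (b : Z → ℝ) (T : ℝ≥0) {δ : ℝ} (hδ : 0 < δ) :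
    ∃ p : ℝ≥0∞, 0 < p ∧ ∀ (Ω : Type*) [MeasurableSpace Ω] (P : Measure Ω) [IsProbabilityMeasure P]
      (W : Z → ℝ≥0 → Ω → ℝ) (S : ℝ≥0 → Ω → ℝ≥0), IsNoise P Z νS W S →
      ∃ A : Set Ω, p ≤ P A ∧ ∀ᵐ ω ∂P, ω ∈ A →
        ∀ k, Measurable (fun t => b k * W k (S t ω) ω) ∧
          ∀ t ≤ T, |b k * W k (S t ω) ω| ≤ δ := by
  set δ' : ℝ := δ / (1 + ∑ k, |b k|) with hδ'
  have hsum0 : 0 ≤ ∑ k, |b k| := Finset.sum_nonneg fun k _ => abs_nonneg _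
  have hδ'0 : 0 < δ' := by positivity
  have hbδ : ∀ k, |b k| * δ' ≤ δ := by
    intro k
    have h1 : |b k| ≤ ∑ k, |b k| :=
      Finset.single_le_sum (f := fun k => |b k|) (fun k _ => abs_nonneg _) (Finset.mem_univ k)
    rw [hδ', mul_div_assoc', div_le_iff₀ (by positivity)]
    nlinarith
  set θ : ℝ := 1 / (2 * (Fintype.card Z + 1)) with hθ
  have hθ0 : 0 < θ := by positivity
  obtain ⟨ε, hε0, hε⟩ := exists_prob_brownian_small hδ'0 hθ0
  obtain ⟨p, hp0, hp⟩ := exists_le_prob_subordinator_le hνS T hε0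
  refine ⟨ENNReal.ofReal (1 / 2) * ENNReal.ofReal p,
    ENNReal.mul_pos (ENNReal.ofReal_pos.2 (by norm_num)).ne' (ENNReal.ofReal_pos.2 hp0).ne', ?_⟩
  intro Ω _ P _ W S hN
  set E : Set (Z × ℝ≥0 → ℝ) := {f | ∀ k : Z, ∀ n i : ℕ, i ≤ 2 ^ n →
    |f (k, ε * (i / 2 ^ n))| ≤ δ'} with hE
  have hEm : MeasurableSet E := by
    have : E = ⋂ k : Z, ⋂ n : ℕ, ⋂ i : ℕ, ⋂ _ : i ≤ 2 ^ n,
        {f | |f (k, ε * (i / 2 ^ n))| ≤ δ'} := by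
      ext f
      simp [hE]
    rw [this]
    refine MeasurableSet.iInter fun k => MeasurableSet.iInter fun n => MeasurableSet.iInter fun i =>
      MeasurableSet.iInter fun _ => measurableSet_le ?_ measurable_const
    exact (measurable_pi_apply (k, ε * ((i : ℝ≥0) / 2 ^ n))).abs
  set G : Set (ℝ≥0 → ℝ≥0) := {f | f T ≤ ε} with hG
  have hGm : MeasurableSet G := measurableSet_le (measurable_pi_apply T) measurable_const
  have hind := hN.indep_subordinator.measure_inter_preimage_eq_mul E G hEm hGm
  refine ⟨(fun ω (q : Z × ℝ≥0) => W q.1 q.2 ω) ⁻¹' E ∩ (fun ω t => S t ω) ⁻¹' G, ?_, ?_⟩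
  · rw [hind]
    have hWm : MeasurableSet ((fun ω (q : Z × ℝ≥0) => W q.1 q.2 ω) ⁻¹' E) :=
      hEm.preimage (measurable_pi_lambda _ fun q => hN.measurable q.1 q.2)
    have hcompl : P ((fun ω (q : Z × ℝ≥0) => W q.1 q.2 ω) ⁻¹' E)ᶜ ≤ ENNReal.ofReal (1 / 2) := by
      have hsub : ((fun ω (q : Z × ℝ≥0) => W q.1 q.2 ω) ⁻¹' E)ᶜ ⊆
          ⋃ k : Z, {ω | ∀ n i : ℕ, i ≤ 2 ^ n → |W k (ε * (i / 2 ^ n)) ω| ≤ δ'}ᶜ := by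
        intro ω hω
        by_contra hcon
        simp only [Set.mem_iUnion, Set.mem_compl_iff, not_exists, not_not] at hcon
        exact hω fun k => hcon k
      refine (measure_mono hsub).trans ((measure_iUnion_le _).trans ?_)
      rw [tsum_fintype]
      refine (Finset.sum_le_sum fun k _ =>
        hε Ω P (W k) (hN.brownian k).toIsPreBrownianReal).trans ?_
      rw [Finset.sum_const, Finset.card_univ, ← ENNReal.ofReal_nsmul]
      refine ENNReal.ofReal_le_ofReal ?_
      rw [nsmul_eq_mul, hθ, mul_one_div, div_le_div_iff₀ (by positivity) (by norm_num)]
      linarith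
    have hW : ENNReal.ofReal (1 / 2) ≤ P ((fun ω (q : Z × ℝ≥0) => W q.1 q.2 ω) ⁻¹' E) := by
      have h1 := prob_add_prob_compl (μ := P) hWm
      have h2 : ENNReal.ofReal (1 / 2) + ENNReal.ofReal (1 / 2) = 1 := by
        rw [← ENNReal.ofReal_add (by norm_num) (by norm_num)]
        norm_num
      have h3 : ENNReal.ofReal (1 / 2) + ENNReal.ofReal (1 / 2) ≤
          P ((fun ω (q : Z × ℝ≥0) => W q.1 q.2 ω) ⁻¹' E) + ENNReal.ofReal (1 / 2) := by
        rw [h2, ← h1]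
        gcongr
      exact (ENNReal.add_le_add_iff_right ENNReal.ofReal_ne_top).1 h3
    have hS : ENNReal.ofReal p ≤ P ((fun ω t => S t ω) ⁻¹' G) := by
      have h := ENNReal.ofReal_le_ofReal (hp Ω P S hN.subordinator)
      rw [ofReal_measureReal] at h
      exact h
    gcongr
  · have hcont : ∀ᵐ ω ∂P, ∀ k, Continuous (W k · ω) := ae_all_iff.2 fun k => (hN.brownian k).cont
    filter_upwards [hcont, hN.subordinator.monotone] with ω hWc hSm hω k
    refine ⟨((hWc k).measurable.comp hSm.measurable).const_mul _, fun t ht => ?_⟩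
    have hSt : S t ω ≤ ε := (hSm ht).trans hω.2
    have hWk : |W k (S t ω) ω| ≤ δ' := abs_le_of_dyadic (hWc k) hε0 (hω.1 k) hSt
    rw [abs_mul]
    exact (mul_le_mul_of_nonneg_left hWk (abs_nonneg _)).trans (hbδ k)

end StochNS

theorem proposition1p2 (ν : ℝ) (hν : 0 < ν) (Z : Finset (Fin 2 → ℤ)) (hZ : AdmissibleModes Z)
    (b : Z → ℝ) (hb : ∀ k, b k ≠ 0) (νS : Measure ℝ) (hνS : AdmissibleLevyMeasure νS)
    (C γ : ℝ) (hC : 0 < C) (hγ : 0 < γ) :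
    ∃ T : ℝ≥0, 0 < T ∧ ∃ p : ℝ≥0∞, 0 < p ∧
      ∀ (Ω : Type*) [MeasurableSpace Ω] (P : Measure Ω) [IsProbabilityMeasure P]
        (W : Z → ℝ≥0 → Ω → ℝ) (S : ℝ≥0 → Ω → ℝ≥0), IsNoise P Z νS W S →
        ∀ w₀ : H, ‖w₀‖ ≤ C → ∀ w : ℝ≥0 → Ω → H, IsSolution P ν (forcing b W S) w₀ w →
          p ≤ transitionProb P w T {x : H | ‖x‖ ≤ γ} := by
  obtain ⟨T, hT, δ, hδ, hdet⟩ := exists_time_forcing_bound hν hZ.zero_notMem C hγ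
  obtain ⟨p, hp, hprob⟩ := exists_le_prob_forcing_small hνS b T hδ
  refine ⟨T, hT, p, hp, ?_⟩
  intro Ω _ P _ W S hN w₀ hw₀ w hw
  obtain ⟨A, hpA, hA⟩ := hprob Ω P W S hN
  have hball : MeasurableSet {x : H | ‖x‖ ≤ γ} :=
    (isClosed_le continuous_norm continuous_const).measurableSet
  rw [transitionProb, Measure.map_apply_of_aemeasurable (hw.aemeasurable T) hball]
  refine hpA.trans (measure_mono_ae ?_)
  filter_upwards [hA, hw.path] with ω hω hpath hωA
  exact hdet (fun k t => b k * W k (S t ω) ω) (fun k => (hω hωA k).1) (fun k => (hω hωA k).2)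
    w₀ hw₀ (fun t => w t ω) hpath
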